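/- Consider the deterministic $\mathsf{LOCAL}$ model: the network is a finite simple undirected graph $G$ with $n$ nodes and maximum degree $\Delta\ge 2$. Every node has a unique identifier from $\{0,\dots,n^c-1\}$, where $c$ is a constant, and an arbitrary numbering of its incident edges; initially it knows its identifier, its degree, $n$, $\Delta$ and $\varepsilon$. In each synchronous round every node sends a message of arbitrary size to each neighbor, receives its neighbors' messages, and performs an arbitrary local computation. At the end every node outputs the colors of its incident edges, and the two endpoints of an edge must output the same color. Logarithms are to base $2$. For every constant $c$ there are a constant $C=C(c)>0$ and a deterministic distributed algorithm such that, for every such network and every real $\varepsilon>1/\log\Delta$, the algorithm computes a proper edge coloring of $G$ with the $\lfloor(2+\varepsilon)\Delta\rfloor$ colors $0,1,\dots,\lfloor(2+\varepsilon)\Delta\rfloor-1$ in at most $$C\cdot \log^2\Delta\cdot\max\{1,\varepsilon^{-1}\}\cdot\max\{1,\log\log\Delta\}\cdot\bigl(\max\{1,\log\log\log\Delta\}\bigr)^{1.71}\cdot\log n$$ rounds. For $\varepsilon\le 1$ and $\Delta\ge 16$ this bound is $O\bigl(\log^2\Delta\cdot\varepsilon^{-1}\cdot\log\log\Delta\cdot(\log\log\log\Delta)^{1.71}\cdot\log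 n\bigr)$; the constants depend only on $c$, not on $n$, $\Delta$ or $\varepsilon$. -/

import Mathlib

/-- A deterministic distributed algorithm for the `LOCAL` model whose output is a natural number
(a colour) for each incident edge of each node.  A node of degree `d` addresses its incident edges
through its ports `Fin d`.  Local computation and message sizes are unrestricted. -/
structure LocalAlgorithm where
  /-- local states of a node -/
  State : Type
  /-- messages -/
  Msg : Type
  /-- number of synchronous rounds, as a function of the number of nodes `n`, the maximum
  degree `Δ` and the parameter `ε` -/
  rounds : (n Δ : ℕ) → (ε : ℝ) → ℕ
  /-- initial state of a node, from `n`, `Δ`, `ε`, its own identifier and its own degree -/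
  init : (n Δ : ℕ) → (ε : ℝ) → (ident d : ℕ) → State
  /-- the message that a node of degree `d` sends through each of its ports -/
  send : (d : ℕ) → State → Fin d → Msg
  /-- new state of a node of degree `d`, from its old state and the messages received through
  its ports -/
  receive : (d : ℕ) → State → (Fin d → Msg) → State
  /-- the colours that a node of degree `d` finally outputs for the edges at its ports -/
  output : (d : ℕ) → State → Fin d → ℕ

namespace LocalAlgorithm

variable {V : Type} [Fintype V] (G : SimpleGraph V) [DecidableRel G.Adj]

/-- A port numbering: every node numbers its neighbours by `0, …, degree - 1`. -/
abbrev PortNumbering : Type :=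
  (v : V) → Fin (G.degree v) ≃ G.neighborSet v

variable {G}

/-- The state of node `v` after `t` rounds of `A` on `G`.  In each round a node `v` receives,
through its port `i` leading to the neighbour `w`, the message which `w` sends through its port
leading to `v`. -/
def stateAfter (A : LocalAlgorithm) (ident : V → ℕ) (port : PortNumbering G) (ε : ℝ) :
    ℕ → V → A.State
  | 0, v => A.init (Fintype.card V) G.maxDegree ε (ident v) (G.degree v)
  | t + 1, v =>
      A.receive (G.degree v) (stateAfter A ident port ε t v) fun i =>
        A.send (G.degree (port v i)) (stateAfter A ident port ε t (port v i))
          ((port (port v i)).symm ⟨v, SimpleGraph.Adj.symm (port v i).2⟩)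

/-- The colour that node `v` outputs for the edge at its port `i`, after all rounds. -/
def finalOutput (A : LocalAlgorithm) (ident : V → ℕ) (port : PortNumbering G) (ε : ℝ)
    (v : V) (i : Fin (G.degree v)) : ℕ :=
  A.output (G.degree v)
    (stateAfter A ident port ε (A.rounds (Fintype.card V) G.maxDegree ε) v) i

/-- The outputs form a proper edge colouring of `G` with the `k` colours `0, …, k - 1`: both
endpoints of each edge output the colour of that edge. -/
def ComputesEdgeColoring (A : LocalAlgorithm) (ident : V → ℕ) (port : PortNumbering G) (ε : ℝ)
    (k : ℕ) : Prop :=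
  ∃ κ : G.lineGraph.Coloring (Fin k), ∀ (v : V) (i : Fin (G.degree v)),
    A.finalOutput ident port ε v i =
      (κ ⟨s(v, (port v i : V)), (port v i).2⟩ : ℕ)

end LocalAlgorithm

/-! The plan is to colour the line graph properly with `D = 2Δ` colours in O(log²Δ · log n) rounds.
As ε is positive, these colours are available, and the other factors of the stated bound are at
least one. A round on the line graph costs one round of the network, since both ends of an edge can
keep the state of that edge (`stateAfter_simulation`).

The colouring derandomises a simple trial. An uncoloured vertex takes `2 ^ i` free colours, a number
that exceeds half its count of uncoloured neighbours, and three times as many dummy colours, and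
draws one candidate uniformly. The expected number of dummies drawn plus the expected number of
conflicts, counted at both ends, is at most 7/8 per uncoloured vertex (`cost_fill_le`). To
derandomise, the lists are halved until one candidate is left. The vertices decide class by class of
an auxiliary colouring, each choosing the half of smaller expected cost. This is the method of
conditional expectations for edges between classes; an edge inside a class may become up to four
times as costly (`halveAll_spec`). If at most a fraction 1/(48s) of the cost lies inside classes,
then s halvings multiply the cost by at most 16/15 (`exists_roundList`). Every vertex still
uncoloured accounts for cost at least one, so at most 14/15 of the uncoloured vertices remain
(`exists_iteration`), and O(log n) repetitions finish (`exists_coloring`).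

The speed depends on having only O(log Δ) classes. Polynomial codes give weighted defective
colourings (`exists_defectStep`), and with unit weights also Linial's proper colouring
(`exists_baseColoring`). Two such steps give poly(log log Δ) classes for a coarser rounding problem,
in which the class itself is the random choice. Solving that by the same halving gives `2 ^ r` =
O(log Δ) classes of small weight (`exists_coarse`). Each of the O(log Δ) halvings then takes O(log
Δ) rounds (`iterLength_le`). -/

open scoped Classical in
/-- The neighbours of a vertex, as a finset. -/
noncomputable def SimpleGraph.nbr {V : Type} [Fintype V] (H : SimpleGraph V) (v : V) : Finset V :=
  Finset.univ.filter (H.Adj v)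

/-! ### Rounds on a graph, list averages and halves. -/

namespace ListRounding

open Finset

/-- One synchronous round in which every vertex reads the states of all its neighbours. -/
abbrev Step (S : Type) : Type := S → Multiset S → S

variable {V : Type} [Fintype V] (H : SimpleGraph V) {S : Type}

@[simp] theorem mem_nbr {u v : V} : u ∈ H.nbr v ↔ H.Adj v u := by
  simp [SimpleGraph.nbr]

/-- The effect of a round on the configuration of the network. -/
noncomputable def step (F : Step S) (x : V → S) : V → S :=
  fun v => F (x v) ((H.nbr v).val.map x)

/-- The configuration reached after a list of rounds. -/
noncomputable def run (P : List (Step S)) (x : V → S) : V → S :=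
  P.foldl (fun x F => step H F x) x

@[simp] theorem run_nil (x : V → S) : run H [] x = x := rfl

@[simp] theorem run_cons (F : Step S) (P : List (Step S)) (x : V → S) :
    run H (F :: P) x = run H P (step H F x) := rfl

@[simp] theorem run_append (P Q : List (Step S)) (x : V → S) :
    run H (P ++ Q) x = run H Q (run H P x) := by
  simp [run]

theorem sum_map_nbr (x : V → S) (v : V) (φ : S → ℝ) :
    (((H.nbr v).val.map x).map φ).sum = ∑ u ∈ H.nbr v, φ (x u) := by
  rw [Multiset.map_map]; rfl

/-- Sums over ordered pairs of adjacent vertices are symmetric. -/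
theorem sum_nbr_comm (f : V → V → ℝ) :
    ∑ v, ∑ u ∈ H.nbr v, f v u = ∑ v, ∑ u ∈ H.nbr v, f u v := by
  classical
  simp only [SimpleGraph.nbr, sum_filter]
  rw [sum_comm]
  simp only [H.adj_comm]

/-- Average of `f` over `A`. -/
noncomputable def avg (f : ℕ → ℝ) (A : Finset ℕ) : ℝ := (∑ c ∈ A, f c) / #A

/-- The probability that independent uniform elements of `A` and `B` coincide, with colour `c`
counted with weight `μ c`. -/
noncomputable def overlap (μ : ℕ → ℝ) (A B : Finset ℕ) : ℝ := (∑ c ∈ A ∩ B, μ c) / (#A * #B)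

theorem overlap_comm (μ : ℕ → ℝ) (A B : Finset ℕ) : overlap μ A B = overlap μ B A := by
  simp [overlap, inter_comm, mul_comm]

theorem overlap_nonneg {μ : ℕ → ℝ} (hμ : ∀ c, 0 ≤ μ c) (A B : Finset ℕ) : 0 ≤ overlap μ A B := by
  unfold overlap
  have := sum_nonneg (s := A ∩ B) (fun c _ => hμ c)
  positivity

theorem avg_nonneg {h : ℕ → ℝ} (hh : ∀ c, 0 ≤ h c) (A : Finset ℕ) : 0 ≤ avg h A := by
  unfold avg
  have := sum_nonneg (s := A) (fun c _ => hh c)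
  positivity

theorem overlap_eq_avg (μ : ℕ → ℝ) (A B : Finset ℕ) :
    overlap μ A B = avg (fun c => if c ∈ B then μ c / #B else 0) A := by
  unfold overlap avg
  rw [← sum_filter, filter_mem_eq_inter, ← sum_div, div_div, mul_comm]

/-- `A'` is one half of `A`, or `A` cannot be halved and is kept. -/
def IsHalf (A' A : Finset ℕ) : Prop := A' ⊆ A ∧ (2 * #A' = #A ∨ Odd #A ∧ A' = A)

/-- The average over an even list is the mean of the averages over two complementary halves, so one
of these does no worse. -/
theorem exists_half (A : Finset ℕ) (f : ℕ → ℝ) : ∃ A', IsHalf A' A ∧ avg f A' ≤ avg f A := by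
  rcases Nat.even_or_odd #A with ⟨m, hm⟩ | ho
  · obtain ⟨B, hB, hBc⟩ := exists_subset_card_eq (s := A) (n := m) (by omega)
    have hs : ∑ c ∈ A \ B, f c + ∑ c ∈ B, f c = ∑ c ∈ A, f c := sum_sdiff hB
    have hc : #(A \ B) = m := by rw [card_sdiff_of_subset hB]; omega
    have hA : (#A : ℝ) = 2 * m := by rw [hm]; push_cast; ring
    rcases le_total (∑ c ∈ A \ B, f c) (∑ c ∈ B, f c) with h | h
    · refine ⟨A \ B, ⟨sdiff_subset, Or.inl (by omega)⟩, ?_⟩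
      unfold avg
      rw [hc, hA, ← div_div]
      gcongr
      linarith
    · refine ⟨B, ⟨hB, Or.inl (by omega)⟩, ?_⟩
      unfold avg
      rw [hBc, hA, ← div_div]
      gcongr
      linarith
  · exact ⟨A, ⟨Subset.rfl, Or.inr ⟨ho, rfl⟩⟩, le_rfl⟩

/-- A half of `A` on which the average of `f` is not larger. -/
noncomputable def half (A : Finset ℕ) (f : ℕ → ℝ) : Finset ℕ := (exists_half A f).choose

theorem isHalf_half (A : Finset ℕ) (f : ℕ → ℝ) : IsHalf (half A f) A :=
  (exists_half A f).choose_spec.1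

theorem avg_half_le (A : Finset ℕ) (f : ℕ → ℝ) : avg f (half A f) ≤ avg f A :=
  (exists_half A f).choose_spec.2

theorem IsHalf.card_le {A' A : Finset ℕ} (h : IsHalf A' A) : #A ≤ 2 * #A' := by
  rcases h.2 with h | ⟨_, rfl⟩ <;> omega

theorem IsHalf.card_eq_two_pow {A' A : Finset ℕ} (h : IsHalf A' A) {i : ℕ} (hA : #A = 2 ^ i) :
    #A' = 2 ^ (i - 1) := by
  rcases i with _ | i
  · rcases h.2 with h | ⟨_, rfl⟩
    · simp at hA; omega
    · simpa using hA
  · rcases h.2 with h | ⟨ho, rfl⟩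
    · rw [hA, pow_succ] at h
      simp; omega
    · rw [hA] at ho
      exact absurd ho (by simp [pow_succ])

/-- The numerator can only shrink, and each of the two list sizes in the denominator drops by at
most a factor two. -/
theorem overlap_le_of_isHalf {μ : ℕ → ℝ} (hμ : ∀ c, 0 ≤ μ c) {A A' B B' : Finset ℕ}
    (hA : IsHalf A' A) (hB : IsHalf B' B) : overlap μ A' B' ≤ 4 * overlap μ A B := by
  unfold overlap
  have h1 : ∑ c ∈ A' ∩ B', μ c ≤ ∑ c ∈ A ∩ B, μ c :=
    sum_le_sum_of_subset_of_nonneg (inter_subset_inter hA.1 hB.1) fun c _ _ => hμ c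
  have h0 : 0 ≤ ∑ c ∈ A' ∩ B', μ c := sum_nonneg fun c _ => hμ c
  have hA2 : (#A : ℝ) ≤ 2 * #A' := by exact_mod_cast hA.card_le
  have hB2 : (#B : ℝ) ≤ 2 * #B' := by exact_mod_cast hB.card_le
  rcases Nat.eq_zero_or_pos #A with hA0 | hA0
  · have : A = ∅ := by simpa using hA0
    have : A' = ∅ := subset_empty.1 (this ▸ hA.1)
    simp_all
  rcases Nat.eq_zero_or_pos #B with hB0 | hB0
  · have : B = ∅ := by simpa using hB0
    have : B' = ∅ := subset_empty.1 (this ▸ hB.1)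
    simp_all
  have hA0' : (0 : ℝ) < #A := by exact_mod_cast hA0
  have hB0' : (0 : ℝ) < #B := by exact_mod_cast hB0
  calc (∑ c ∈ A' ∩ B', μ c) / (#A' * #B') ≤ (∑ c ∈ A' ∩ B', μ c) / ((#A / 2) * (#B / 2)) := by
        apply div_le_div_of_nonneg_left h0 (by positivity)
        apply mul_le_mul <;> first | positivity | linarith
    _ ≤ (∑ c ∈ A ∩ B, μ c) / ((#A / 2) * (#B / 2)) := by gcongr
    _ = 4 * ((∑ c ∈ A ∩ B, μ c) / (#A * #B)) := by field_simp; ring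

/-! ### Expected cost and conditional expectations. -/

/-- Expected cost of choosing a uniform colour from each list independently: colour `c` costs `h c`
at its vertex, and an edge `vu` on which both ends choose `c` costs `W v u * μ c` in each
direction. -/
noncomputable def cost (W : V → V → ℝ) (μ h : ℕ → ℝ) (L : V → Finset ℕ) : ℝ :=
  ∑ v, (avg h (L v) + ∑ u ∈ H.nbr v, W v u * overlap μ (L v) (L u))

open scoped Classical in
/-- The part of the expected edge cost that comes from edges inside the classes of `κ`. -/
noncomputable def monoCost (W : V → V → ℝ) (μ : ℕ → ℝ) (κ : V → ℕ) (L : V → Finset ℕ) : ℝ :=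
  ∑ v, ∑ u ∈ H.nbr v, if κ u = κ v then W v u * overlap μ (L v) (L u) else 0

open scoped Classical in
/-- The remaining part of the expected cost. -/
noncomputable def crossCost (W : V → V → ℝ) (μ h : ℕ → ℝ) (κ : V → ℕ) (L : V → Finset ℕ) : ℝ :=
  ∑ v, (avg h (L v) + ∑ u ∈ H.nbr v, if κ u = κ v then 0 else W v u * overlap μ (L v) (L u))

theorem cost_eq_add (W : V → V → ℝ) (μ h : ℕ → ℝ) (κ : V → ℕ) (L : V → Finset ℕ) :
    cost H W μ h L = crossCost H W μ h κ L + monoCost H W μ κ L := by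
  unfold cost crossCost monoCost
  rw [← sum_add_distrib]
  refine sum_congr rfl fun v _ => ?_
  rw [add_assoc, ← sum_add_distrib]
  congr 1
  refine sum_congr rfl fun u _ => ?_
  split_ifs <;> simp

/-- Cost of colour `c` at a vertex `v`, given the lists of its neighbours in other classes. -/
noncomputable def colorCost (W : V → V → ℝ) (μ h : ℕ → ℝ) (κ : V → ℕ) (L : V → Finset ℕ)
    (v : V) (c : ℕ) : ℝ :=
  h c + 2 * ∑ u ∈ H.nbr v, if κ u = κ v then 0 else
    W v u * (if c ∈ L u then μ c / #(L u) else 0)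

/-- For symmetric `W` this is the part of the cross cost that depends on the list of `v`. The factor
2 is there because the cost counts every edge from both ends. -/
theorem avg_colorCost (W : V → V → ℝ) (μ h : ℕ → ℝ) (κ : V → ℕ) (L : V → Finset ℕ)
    (v : V) (A : Finset ℕ) :
    avg (colorCost H W μ h κ L v) A =
      avg h A + 2 * ∑ u ∈ H.nbr v, if κ u = κ v then 0 else W v u * overlap μ A (L u) := by
  simp only [overlap_eq_avg]
  unfold avg colorCost
  rw [sum_add_distrib, add_div, ← mul_sum, mul_div_assoc, sum_comm]
  congr 2
  rw [sum_div]
  refine sum_congr rfl fun u _ => ?_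
  split_ifs
  · simp
  · rw [← mul_sum, mul_div_assoc]

/-- If the vertices of one class choose lists of smaller average cost, the cross cost drops. -/
theorem crossCost_le {W : V → V → ℝ} (hW : ∀ u v, W u v = W v u) {μ h : ℕ → ℝ} {κ : V → ℕ}
    {L L' : V → Finset ℕ} (j : ℕ) (h1 : ∀ v, κ v ≠ j → L' v = L v)
    (h2 : ∀ v, κ v = j → avg (colorCost H W μ h κ L v) (L' v) ≤ avg (colorCost H W μ h κ L v) (L v)) :
    crossCost H W μ h κ L' ≤ crossCost H W μ h κ L := by
  classical
  set D : V → V → ℝ := fun v u =>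
    if κ u = κ v then 0 else W v u * (overlap μ (L' v) (L' u) - overlap μ (L v) (L u)) with hD
  have hDs : ∀ v u, D v u = D u v := by
    intro v u
    simp only [hD, hW v u, overlap_comm μ (L' v), overlap_comm μ (L v), eq_comm (a := κ u)]
  -- Only pairs with exactly one end in class `j` change: pairs inside the class do not enter the
  -- cross cost. Hence the vertices of the class can decide simultaneously.
  have hsplit : ∀ v u, D v u = (if κ v = j then D v u else 0) + (if κ u = j then D v u else 0) := by
    intro v u
    by_cases hv : κ v = j <;> by_cases hu : κ u = j
    · simp [hD, hv, hu]
    · simp [hv, hu]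
    · simp [hv, hu]
    · simp [hD, hv, hu, h1]
  have hsum : ∑ v, ∑ u ∈ H.nbr v, D v u = ∑ v, ∑ u ∈ H.nbr v, (if κ v = j then 2 * D v u else 0) := by
    calc ∑ v, ∑ u ∈ H.nbr v, D v u
        = ∑ v, ∑ u ∈ H.nbr v, (if κ v = j then D v u else 0)
          + ∑ v, ∑ u ∈ H.nbr v, (if κ u = j then D v u else 0) := by
          simp only [← sum_add_distrib]
          exact sum_congr rfl fun v _ => sum_congr rfl fun u _ => hsplit v u
      _ = ∑ v, ∑ u ∈ H.nbr v, (if κ v = j then D v u else 0)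
          + ∑ v, ∑ u ∈ H.nbr v, (if κ v = j then D v u else 0) := by
          congr 1
          rw [sum_nbr_comm]
          exact sum_congr rfl fun v _ => sum_congr rfl fun u _ => by rw [hDs]
      _ = _ := by
          simp only [← sum_add_distrib]
          refine sum_congr rfl fun v _ => sum_congr rfl fun u _ => ?_
          split_ifs <;> ring
  have hdiff : crossCost H W μ h κ L' - crossCost H W μ h κ L
      = ∑ v, (if κ v = j then avg (colorCost H W μ h κ L v) (L' v)
          - avg (colorCost H W μ h κ L v) (L v) else 0) := by
    have : crossCost H W μ h κ L' - crossCost H W μ h κ L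
        = ∑ v, (avg h (L' v) - avg h (L v)) + ∑ v, ∑ u ∈ H.nbr v, D v u := by
      unfold crossCost
      rw [← sum_sub_distrib, ← sum_add_distrib]
      refine sum_congr rfl fun v _ => ?_
      rw [add_sub_add_comm, ← sum_sub_distrib]
      congr 1
      refine sum_congr rfl fun u _ => ?_
      simp only [hD]
      split_ifs <;> ring
    rw [this, hsum, ← sum_add_distrib]
    refine sum_congr rfl fun v _ => ?_
    by_cases hv : κ v = j
    · simp only [hv, if_true, avg_colorCost]
      rw [add_sub_add_comm, ← mul_sub, ← sum_sub_distrib, ← mul_sum]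
      congr 2
      refine sum_congr rfl fun u _ => ?_
      simp only [hD, hv]
      by_cases hu : κ u = j
      · simp [hu]
      · simp only [hu, if_false, h1 u hu]; ring
    · simp [hv, h1 v hv]
  have : ∑ v, (if κ v = j then avg (colorCost H W μ h κ L v) (L' v)
          - avg (colorCost H W μ h κ L v) (L v) else 0) ≤ 0 := by
    refine sum_nonpos fun v _ => ?_
    split_ifs with hv
    · linarith [h2 v hv]
    · exact le_rfl
  linarith

/-! ### Halving lists by synchronous rounds. -/

/-- A field of the state that holds a list of colours, together with a field `cls` that is not
affected by updates of the list. -/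
structure ListField (S : Type) (cls : S → ℕ) where
  get : S → Finset ℕ
  set : S → Finset ℕ → S
  get_set : ∀ s A, get (set s A) = A
  set_set : ∀ s A B, set (set s A) B = set s B
  set_get : ∀ s, set s (get s) = s
  cls_set : ∀ s A, cls (set s A) = cls s

variable {cls : S → ℕ} (f : ListField S cls)

/-- The round in which the vertices of class `j` halve their lists. -/
noncomputable def halveStep (wt : S → S → ℝ) (μ h : ℕ → ℝ) (j : ℕ) : Step S := fun s ms =>
  if cls s = j then
    f.set s (half (f.get s) fun c => h c + 2 * (ms.map fun t => if cls t = cls s then 0 else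
      wt s t * (if c ∈ f.get t then μ c / #(f.get t) else 0)).sum)
  else s

/-- Halving all lists, class by class. -/
noncomputable def halveAll (wt : S → S → ℝ) (μ h : ℕ → ℝ) (K : ℕ) : List (Step S) :=
  (List.range K).map (halveStep f wt μ h)

@[simp] theorem length_halveAll (wt : S → S → ℝ) (μ h : ℕ → ℝ) (K : ℕ) :
    (halveAll f wt μ h K).length = K := by simp [halveAll]

theorem halveStep_spec {wt : S → S → ℝ} {μ h : ℕ → ℝ} {W : V → V → ℝ} (hW : ∀ u v, W u v = W v u)
    (j : ℕ) (x : V → S) (hwt : ∀ u v, wt (x u) (x v) = W u v) :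
    ∃ L' : V → Finset ℕ, (∀ v, step H (halveStep f wt μ h j) x v = f.set (x v) (L' v)) ∧
      (∀ v, cls (x v) ≠ j → L' v = f.get (x v)) ∧ (∀ v, cls (x v) = j → IsHalf (L' v) (f.get (x v))) ∧
      crossCost H W μ h (fun v => cls (x v)) L'
        ≤ crossCost H W μ h (fun v => cls (x v)) (fun v => f.get (x v)) := by
  classical
  set L : V → Finset ℕ := fun v => f.get (x v) with hL
  set κ : V → ℕ := fun v => cls (x v) with hκ
  refine ⟨fun v => if κ v = j then half (L v) (colorCost H W μ h κ L v) else L v, ?_, ?_, ?_, ?_⟩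
  · intro v
    unfold step halveStep
    by_cases hv : cls (x v) = j
    · simp only [hv, hκ, if_true]
      congr 2
      funext c
      rw [sum_map_nbr H x v]
      simp only [hwt, colorCost, hL, hv]
    · simp [hv, hκ, hL, f.set_get]
  · intro v hv; simp [hκ, hv, hL]
  · intro v hv; simp only [hκ, hv, if_true]; exact isHalf_half _ _
  · refine crossCost_le H hW j (fun v hv => by simp [hv]) fun v hv => ?_
    simp only [hv, if_true]
    exact avg_half_le _ _

/-- No class increases the cross cost at its turn. The cost inside classes is not controlled during
the process, but it grows at most fourfold, which adds at most three times its old value. -/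
theorem halveAll_spec {wt : S → S → ℝ} {μ h : ℕ → ℝ} (hμ : ∀ c, 0 ≤ μ c) {W : V → V → ℝ}
    (hW : ∀ u v, W u v = W v u) (hW0 : ∀ u v, 0 ≤ W u v) (K : ℕ) (x : V → S)
    (hwt : ∀ (L : V → Finset ℕ) u v, wt (f.set (x u) (L u)) (f.set (x v) (L v)) = W u v)
    (hK : ∀ v, cls (x v) < K) :
    ∃ L' : V → Finset ℕ, (∀ v, run H (halveAll f wt μ h K) x v = f.set (x v) (L' v)) ∧
      (∀ v, IsHalf (L' v) (f.get (x v))) ∧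
      cost H W μ h L' ≤ cost H W μ h (fun v => f.get (x v))
        + 3 * monoCost H W μ (fun v => cls (x v)) (fun v => f.get (x v)) := by
  classical
  have key : ∀ k, ∃ L' : V → Finset ℕ,
      (∀ v, run H (halveAll f wt μ h k) x v = f.set (x v) (L' v)) ∧
      (∀ v, k ≤ cls (x v) → L' v = f.get (x v)) ∧
      (∀ v, cls (x v) < k → IsHalf (L' v) (f.get (x v))) ∧
      crossCost H W μ h (fun v => cls (x v)) L'
        ≤ crossCost H W μ h (fun v => cls (x v)) (fun v => f.get (x v)) := by
    intro k
    induction k with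
    | zero => exact ⟨fun v => f.get (x v), by simp [halveAll, f.set_get], by simp, by simp, le_rfl⟩
    | succ k ih =>
      obtain ⟨L, h1, h2, h3, h4⟩ := ih
      have hrun : run H (halveAll f wt μ h (k + 1)) x
          = step H (halveStep f wt μ h k) (fun v => f.set (x v) (L v)) := by
        rw [halveAll, List.range_succ, List.map_append, run_append]
        have : run H ((List.range k).map (halveStep f wt μ h)) x = fun v => f.set (x v) (L v) :=
          funext h1
        rw [this]; rfl
      obtain ⟨L', g1, g2, g3, g4⟩ := halveStep_spec H f (μ := μ) (h := h) hW k
        (fun v => f.set (x v) (L v)) (hwt L)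
      simp only [f.cls_set, f.get_set] at g2 g3 g4
      refine ⟨L', ?_, ?_, ?_, g4.trans h4⟩
      · intro v; rw [hrun, g1, f.set_set]
      · intro v hv; rw [g2 v (by omega), h2 v (by omega)]
      · intro v hv
        rcases (Nat.lt_succ_iff_lt_or_eq.1 hv) with h | h
        · rw [g2 v (by omega)]; exact h3 v h
        · have := g3 v h
          rwa [h2 v (by omega)] at this
  obtain ⟨L', h1, -, h3, h4⟩ := key K
  refine ⟨L', h1, fun v => h3 v (hK v), ?_⟩
  have hm : monoCost H W μ (fun v => cls (x v)) L'
      ≤ 4 * monoCost H W μ (fun v => cls (x v)) (fun v => f.get (x v)) := by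
    unfold monoCost
    rw [mul_sum]
    refine sum_le_sum fun v _ => ?_
    rw [mul_sum]
    refine sum_le_sum fun u _ => ?_
    split_ifs
    · have := overlap_le_of_isHalf hμ (h3 v (hK v)) (h3 u (hK u))
      have := mul_le_mul_of_nonneg_left this (hW0 v u)
      linarith
    · simp
  rw [cost_eq_add H W μ h (fun v => cls (x v)), cost_eq_add H W μ h (fun v => cls (x v))]
  linarith

/-- Repeatedly compute classes by `P` and halve all lists. -/
noncomputable def roundLists (wt : S → S → ℝ) (μ h : ℕ → ℝ) (K : ℕ) (P : List (Step S)) :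
    ℕ → List (Step S)
  | 0 => []
  | s + 1 => (P ++ halveAll f wt μ h K) ++ roundLists wt μ h K P s

theorem length_roundLists (wt : S → S → ℝ) (μ h : ℕ → ℝ) (K : ℕ) (P : List (Step S)) (s : ℕ) :
    (roundLists f wt μ h K P s).length = s * (P.length + K) := by
  induction s with
  | zero => simp [roundLists]
  | succ s ih => simp only [roundLists, List.length_append, length_halveAll, ih]; ring

/-- Each halving costs a factor `1 + 3 * δ`. The invariant `Inv` serves to fix the state fields read
by `wt`, so that the weights are the same `W` throughout. -/
theorem roundLists_spec {wt : S → S → ℝ} {μ h : ℕ → ℝ} (hμ : ∀ c, 0 ≤ μ c) {W : V → V → ℝ}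
    (hW : ∀ u v, W u v = W v u) (hW0 : ∀ u v, 0 ≤ W u v) {K : ℕ} {P : List (Step S)}
    {δ : ℝ} (hδ : 0 ≤ δ) {Inv : (V → S) → Prop}
    (hset : ∀ (x : V → S) (L : V → Finset ℕ), Inv x → Inv (fun v => f.set (x v) (L v)))
    (hwt : ∀ x, Inv x → ∀ u v, wt (x u) (x v) = W u v)
    (hP : ∀ x, Inv x → Inv (run H P x) ∧ (∀ v, f.get (run H P x v) = f.get (x v)) ∧
      (∀ v, cls (run H P x v) < K) ∧
      monoCost H W μ (fun v => cls (run H P x v)) (fun v => f.get (x v))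
        ≤ δ * cost H W μ h (fun v => f.get (x v)))
    (s : ℕ) (x : V → S) (hx : Inv x) :
    Inv (run H (roundLists f wt μ h K P s) x) ∧
      (∀ v, f.get (run H (roundLists f wt μ h K P s) x v) ⊆ f.get (x v)) ∧
      (∀ v i, #(f.get (x v)) = 2 ^ i →
        #(f.get (run H (roundLists f wt μ h K P s) x v)) = 2 ^ (i - s)) ∧
      cost H W μ h (fun v => f.get (run H (roundLists f wt μ h K P s) x v))
        ≤ (1 + 3 * δ) ^ s * cost H W μ h (fun v => f.get (x v)) := by
  induction s generalizing x with
  | zero => simp [roundLists, hx]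
  | succ s ih =>
    obtain ⟨p1, p2, p3, p4⟩ := hP x hx
    obtain ⟨L', h1, h2, h3⟩ := halveAll_spec H f (wt := wt) (h := h) hμ hW hW0 K (run H P x)
      (fun L => hwt _ (hset _ L p1)) p3
    have hy : run H (P ++ halveAll f wt μ h K) x = fun v => f.set (run H P x v) (L' v) := by
      rw [run_append]; exact funext h1
    have hr : run H (roundLists f wt μ h K P (s + 1)) x
        = run H (roundLists f wt μ h K P s) (fun v => f.set (run H P x v) (L' v)) := by
      rw [roundLists, run_append, hy]
    obtain ⟨q1, q2, q3, q4⟩ := ih _ (hset _ L' p1)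
    simp only [f.get_set, p2] at q2 q3 q4 h2 h3
    rw [hr]
    refine ⟨q1, fun v => (q2 v).trans (h2 v).1, fun v i hi => ?_, q4.trans ?_⟩
    · rw [q3 v _ ((h2 v).card_eq_two_pow hi)]
      congr 1; omega
    · rw [pow_succ, mul_assoc]
      gcongr
      linarith

end ListRounding

/-! ### Defective colourings from polynomial codes, and Linial's colouring. -/

namespace ListRounding

open Finset

/-- Functions on the prime field with `q` elements that agree pairwise in few points. -/
theorem exists_code {q : ℕ} (hq : q.Prime) {M d : ℕ} (hM : M ≤ q ^ d) :
    ∃ g : ℕ → Fin q → Fin q, ∀ m < M, ∀ m' < M, m ≠ m' → #{a | g m a = g m' a} ≤ d := by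
  classical
  have : Fact q.Prime := ⟨hq⟩
  obtain ⟨e⟩ : Nonempty (Fin M ↪ (Fin d → ZMod q)) := by
    apply Function.Embedding.nonempty_of_card_le
    simpa [ZMod.card] using hM
  let z : Fin q ≃ ZMod q := Fintype.equivOfCardEq (by simp [ZMod.card])
  -- Reed–Solomon code: distinct polynomials of degree below `d` agree in fewer than `d` points.
  let p : Fin M → Polynomial (ZMod q) := fun m =>
    ((Polynomial.degreeLTEquiv (ZMod q) d).symm (e m) : Polynomial (ZMod q))
  have hp : ∀ m, (p m).degree < d := fun m =>
    Polynomial.mem_degreeLT.1 ((Polynomial.degreeLTEquiv (ZMod q) d).symm (e m)).2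
  have hinj : Function.Injective p := fun a b h =>
    e.injective ((Polynomial.degreeLTEquiv (ZMod q) d).symm.injective (Subtype.ext h))
  refine ⟨fun m a => if h : m < M then z.symm ((p ⟨m, h⟩).eval (z a)) else a, ?_⟩
  intro m hm m' hm' hne
  by_contra hcon
  push Not at hcon
  have hne' : p ⟨m, hm⟩ ≠ p ⟨m', hm'⟩ := fun h => hne (by simpa using hinj h)
  apply hne'
  apply Polynomial.eq_of_degree_sub_lt_of_eval_finset_eq
    ((univ.filter fun a : Fin q => z.symm ((p ⟨m, hm⟩).eval (z a))
      = z.symm ((p ⟨m', hm'⟩).eval (z a))).map z.toEmbedding)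
  · rw [card_map]
    simp only [hm, hm', dif_pos] at hcon
    refine ((Polynomial.degree_sub_le _ _).trans_lt (max_lt (hp _) (hp _))).trans ?_
    exact_mod_cast hcon
  · intro a ha
    simp only [mem_map, mem_filter, mem_univ, true_and] at ha
    obtain ⟨b, hb, rfl⟩ := ha
    exact z.symm.injective hb

/-- State of a vertex in the colouring algorithm: a proper auxiliary colour, the final colour, a
list of candidates for the final colour, a list of candidates for the class, and the class. -/
structure VertexState where
  base : ℕ
  color : Option ℕ
  list : Finset ℕ
  coarse : Finset ℕ
  cls : ℕ

variable {V : Type} [Fintype V] (H : SimpleGraph V)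

/-- The weight of the edges from `v` to vertices of the same class. -/
noncomputable def monoWeight (W : V → V → ℝ) (κ : V → ℕ) (v : V) : ℝ :=
  ∑ u ∈ H.nbr v, if κ u = κ v then W v u else 0

/-- One round turns an `M`-colouring into a colouring with few colours in which every vertex has
only a small additional fraction of its edges within its class. -/
theorem exists_defectStep {wt : VertexState → VertexState → ℝ} (hwt : ∀ s t, 0 ≤ wt s t)
    (M : ℕ) {X : ℕ} (hX : 0 < X) :
    ∃ K ≤ 4 * X ^ 2, ∃ F : Step VertexState, ∀ (V : Type) [Fintype V] (H : SimpleGraph V)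
      (x : V → VertexState), (∀ v, (x v).cls < M) →
      ∃ k : V → ℕ, (∀ v, k v < K) ∧ (∀ v, step H F x v = { x v with cls := k v }) ∧
        ∀ v, monoWeight H (fun v u => wt (x v) (x u)) k v
          ≤ monoWeight H (fun v u => wt (x v) (x u)) (fun v => (x v).cls) v
            + (Nat.clog 2 M : ℝ) / X * ∑ u ∈ H.nbr v, wt (x v) (x u) := by
  classical
  -- Bertrand's postulate; `q ≤ 2 * X` gives the bound on the number `q * q` of new colours.
  obtain ⟨q, hq, hXq, hqX⟩ := Nat.exists_prime_lt_and_le_two_mul X hX.ne'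
  set d := Nat.clog 2 M with hd
  have hM : M ≤ q ^ d := (Nat.le_pow_clog one_lt_two M).trans (Nat.pow_le_pow_left hq.two_le _)
  obtain ⟨g, hg⟩ := exists_code hq hM
  have hq0 : 0 < q := hq.pos
  let φ : VertexState → Multiset VertexState → Fin q → ℝ := fun s ms a =>
    (ms.map fun t => if t.cls ≠ s.cls ∧ g t.cls a = g s.cls a then wt s t else 0).sum
  have hmin : ∀ s ms, ∃ a, ∀ b, φ s ms a ≤ φ s ms b := fun s ms => by
    obtain ⟨a, -, ha⟩ := exists_min_image univ (φ s ms) ⟨⟨0, hq0⟩, mem_univ _⟩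
    exact ⟨a, fun b => ha b (mem_univ _)⟩
  choose pt hpt using hmin
  -- The new colour encodes an evaluation point and the value there. A neighbour of another old
  -- colour conflicts in at most `d` of the `q > X` points, so the point of least conflict weight
  -- adds at most a fraction `d / X`.
  refine ⟨q * q, by nlinarith, fun s ms =>
    { s with cls := pt s ms * q + g s.cls (pt s ms) }, ?_⟩
  intro V _ H x hx
  set a : V → Fin q := fun v => pt (x v) ((H.nbr v).val.map x) with ha
  refine ⟨fun v => a v * q + g (x v).cls (a v), ?_, fun v => rfl, ?_⟩
  · intro v
    have h1 := (a v).2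
    have h2 := (g (x v).cls (a v)).2
    nlinarith
  · intro v
    have hφ : ∀ b, φ (x v) ((H.nbr v).val.map x) b = ∑ u ∈ H.nbr v,
        if (x u).cls ≠ (x v).cls ∧ g (x u).cls b = g (x v).cls b then wt (x v) (x u) else 0 :=
      fun b => sum_map_nbr H x v _
    have hsum : ∑ b, φ (x v) ((H.nbr v).val.map x) b ≤ d * ∑ u ∈ H.nbr v, wt (x v) (x u) := by
      simp only [hφ]
      rw [sum_comm, mul_sum]
      refine sum_le_sum fun u _ => ?_
      by_cases hu : (x u).cls = (x v).cls
      · simp only [hu, ne_eq, not_true_eq_false, false_and, if_false, sum_const_zero]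
        exact mul_nonneg (Nat.cast_nonneg _) (hwt _ _)
      · simp only [ne_eq, hu, not_false_eq_true, true_and]
        rw [← sum_filter, sum_const, nsmul_eq_mul]
        apply mul_le_mul_of_nonneg_right _ (hwt _ _)
        exact_mod_cast hg _ (hx u) _ (hx v) hu
    have hW : 0 ≤ ∑ u ∈ H.nbr v, wt (x v) (x u) := sum_nonneg fun u _ => hwt _ _
    have hle : φ (x v) ((H.nbr v).val.map x) (a v)
        ≤ (d : ℝ) / X * ∑ u ∈ H.nbr v, wt (x v) (x u) := by
      have h1 : (q : ℝ) * φ (x v) ((H.nbr v).val.map x) (a v)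
          ≤ d * ∑ u ∈ H.nbr v, wt (x v) (x u) := by
        refine le_trans ?_ hsum
        have := card_nsmul_le_sum univ (fun b => φ (x v) ((H.nbr v).val.map x) b)
          (φ (x v) ((H.nbr v).val.map x) (a v)) (fun b _ => hpt _ _ b)
        simpa using this
      have hφ0 : 0 ≤ φ (x v) ((H.nbr v).val.map x) (a v) := by
        rw [hφ]
        refine sum_nonneg fun u _ => ?_
        split_ifs
        · exact hwt _ _
        · exact le_rfl
      have hXq' : (X : ℝ) ≤ q := by exact_mod_cast hXq.le
      have hX' : (0 : ℝ) < X := by exact_mod_cast hX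
      rw [div_mul_eq_mul_div, le_div_iff₀ hX']
      nlinarith
    refine le_trans ?_ (add_le_add_right hle _)
    rw [hφ]
    unfold monoWeight
    rw [← sum_add_distrib]
    refine sum_le_sum fun u _ => ?_
    by_cases hk : (a u : ℕ) * q + g (x u).cls (a u) = a v * q + g (x v).cls (a v)
    · have h1 : (a u : ℕ) = a v := by
        have := congrArg (· / q) hk
        simpa [Nat.add_div_of_dvd_right, Nat.mul_add_div, mul_comm _ q, Nat.div_eq_of_lt, hq0]
          using this
      have h2 : a u = a v := Fin.ext h1
      have h3 : g (x u).cls (a v) = g (x v).cls (a v) := by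
        rw [h2] at hk; exact Fin.ext (by omega)
      by_cases hc : (x u).cls = (x v).cls
      · rw [if_pos hk, if_pos hc]; simp [hc]
      · simp [hk, hc, h3]
    · rw [if_neg hk]
      have := hwt (x v) (x u)
      split_ifs <;> linarith

/-- The product (l + 1)⋯(l + k) is k! times a binomial coefficient of l + k, which is at most 2 ^ (l
+ k). -/
theorem pow_le_mul_two_pow (k l : ℕ) : l ^ k ≤ k.factorial * 2 ^ k * 2 ^ l := by
  calc l ^ k ≤ (l + k).descFactorial k := by
        refine le_trans ?_ (Nat.pow_sub_le_descFactorial _ _)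
        apply Nat.pow_le_pow_left; omega
    _ = k.factorial * (l + k).choose k := Nat.descFactorial_eq_factorial_mul_choose _ _
    _ ≤ k.factorial * 2 ^ (l + k) := Nat.mul_le_mul_left _ (Nat.choose_le_two_pow _ _)
    _ = _ := by rw [pow_add]; ring

theorem clog_pow_le (k M : ℕ) (hM : 1 < M) :
    Nat.clog 2 M ^ k ≤ k.factorial * 2 ^ k * 2 * M := by
  refine (pow_le_mul_two_pow k _).trans ?_
  have h1 : 0 < Nat.clog 2 M := Nat.clog_pos one_lt_two hM
  have h2 := Nat.pow_pred_clog_lt_self one_lt_two hM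
  have : 2 ^ Nat.clog 2 M = 2 * 2 ^ (Nat.clog 2 M).pred := by
    rw [← pow_succ', ← Nat.succ_eq_add_one, Nat.succ_pred_eq_of_pos h1]
  rw [this, mul_assoc (k.factorial * 2 ^ k)]
  gcongr

/-- With unit weights the defect is an integer, so the defective step yields a proper colouring as
soon as the defect is below one. -/
theorem monoWeight_one_lt_one_iff (κ : V → ℕ) (v : V) :
    monoWeight H (fun _ _ => 1) κ v < 1 ↔ ∀ u, H.Adj v u → κ u ≠ κ v := by
  unfold monoWeight
  rw [sum_boole]
  have : ((#{u ∈ H.nbr v | κ u = κ v} : ℕ) : ℝ) < 1 ↔ #{u ∈ H.nbr v | κ u = κ v} = 0 := by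
    rw [← Nat.lt_one_iff]; exact_mod_cast Iff.rfl
  rw [this, card_eq_zero, filter_eq_empty_iff]
  simp

/-- Linial's colour reduction: in logarithmically many rounds, unique identifiers are turned into
a proper colouring with a number of colours polynomial in the degree. -/
theorem exists_baseColoring {D : ℕ} (hD : 0 < D) (m : ℕ) : ∀ M ≤ 2 ^ m,
    ∃ P : List (Step VertexState), P.length ≤ m ∧ ∀ (V : Type) [Fintype V] (H : SimpleGraph V)
      (x : V → VertexState), (∀ v, #(H.nbr v) < D) → (∀ v, (x v).cls < M) →
      (∀ v u, H.Adj v u → (x u).cls ≠ (x v).cls) →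
      ∃ k : V → ℕ, (∀ v, k v < (30 * D) ^ 4) ∧ (∀ v, run H P x v = { x v with cls := k v }) ∧
        ∀ v u, H.Adj v u → k u ≠ k v := by
  induction m with
  | zero =>
    intro M hM
    refine ⟨[], le_rfl, fun V _ H x _ hx hp => ⟨fun v => (x v).cls, fun v => ?_, fun v => rfl, hp⟩⟩
    have : 0 < (30 * D) ^ 4 := by positivity
    have := hx v
    change (x v).cls < _
    rw [pow_zero] at hM
    omega
  | succ m ih =>
    intro M hM
    by_cases hMB : M ≤ (30 * D) ^ 4
    · exact ⟨[], Nat.zero_le _, fun V _ H x _ hx hp =>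
        ⟨fun v => (x v).cls, fun v => (hx v).trans_le hMB, fun v => rfl, hp⟩⟩
    push Not at hMB
    set l := Nat.clog 2 M with hl
    have hM1 : 1 < M := lt_of_le_of_lt (Nat.one_le_pow _ _ (by omega)) hMB
    have hl1 : 0 < l := Nat.clog_pos one_lt_two hM1
    obtain ⟨K, hK, F, hF⟩ := exists_defectStep (wt := fun _ _ => 1) (fun _ _ => zero_le_one) M
      (X := D * l + 1) (by omega)
    -- Above `(30 * D) ^ 4` colours, one round at least halves the bound: 4X² ≤ 16D²l² ≤ M/2. The
    -- constant 30 works because 1024 · 768 ≤ 30⁴.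
    have hKM : K ≤ 2 ^ m := by
      have h4 : l ^ 4 ≤ 768 * M := by simpa [Nat.factorial] using clog_pow_le 4 M hM1
      have h5 : (32 * D ^ 2 * l ^ 2) ^ 2 ≤ M ^ 2 := by
        calc (32 * D ^ 2 * l ^ 2) ^ 2 = 1024 * D ^ 4 * l ^ 4 := by ring
          _ ≤ 1024 * D ^ 4 * (768 * M) := by gcongr
          _ ≤ (30 * D) ^ 4 * M := by rw [mul_pow]; nlinarith [Nat.zero_le (D ^ 4 * M)]
          _ ≤ M * M := by gcongr
          _ = M ^ 2 := by ring
      have h6 : 32 * D ^ 2 * l ^ 2 ≤ M := (Nat.pow_le_pow_iff_left two_ne_zero).1 h5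
      have h7 : D * l + 1 ≤ 2 * (D * l) := by
        have : 0 < D * l := by positivity
        omega
      have h8 : (D * l + 1) ^ 2 ≤ (2 * (D * l)) ^ 2 := Nat.pow_le_pow_left h7 2
      rw [pow_succ] at hM
      have : (2 * (D * l)) ^ 2 = 4 * (D ^ 2 * l ^ 2) := by ring
      nlinarith
    obtain ⟨P, hP, hP'⟩ := ih K hKM
    refine ⟨F :: P, by simpa using hP, fun V _ H x hdeg hx hp => ?_⟩
    obtain ⟨k, hk, hk1, hk2⟩ := hF V H x hx
    have hstep : step H F x = fun v => { x v with cls := k v } := funext hk1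
    obtain ⟨k', g1, g2, g3⟩ := hP' V H (step H F x) hdeg (by simpa [hstep] using hk) (by
      rw [hstep]
      intro v
      refine (monoWeight_one_lt_one_iff H k v).1 (lt_of_le_of_lt (hk2 v) ?_)
      have h0 : monoWeight H (fun _ _ => 1) (fun v => (x v).cls) v = 0 :=
        sum_eq_zero fun u hu => if_neg (hp v u ((mem_nbr H).1 hu))
      rw [h0, zero_add]
      simp only [sum_const, nsmul_eq_mul, mul_one]
      have hd : #(H.nbr v) ≤ D := (hdeg v).le
      rw [div_mul_eq_mul_div, div_lt_one (by positivity)]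
      have : l * #(H.nbr v) < D * l + 1 := by
        have := Nat.mul_le_mul_left l hd
        linarith [mul_comm l D]
      exact_mod_cast this)
    refine ⟨k', g1, fun v => ?_, g3⟩
    rw [run_cons, g2, hstep]

end ListRounding

/-! ### From classes of small inner weight to single candidates. -/

namespace ListRounding

open Finset

variable {V : Type} [Fintype V] (H : SimpleGraph V)

/-- The list of candidates for the final colour. -/
def listField : ListField VertexState VertexState.cls where
  get s := s.list
  set s A := { s with list := A }
  get_set _ _ := rfl
  set_set _ _ _ := rfl
  set_get _ := rfl
  cls_set _ _ := rfl

/-- The list of candidates for the class. -/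
def coarseField : ListField VertexState VertexState.cls where
  get s := s.coarse
  set s A := { s with coarse := A }
  get_set _ _ := rfl
  set_set _ _ _ := rfl
  set_get _ := rfl
  cls_set _ _ := rfl

/-- For positive `s` and y = 1/(16s), Bernoulli gives (1 - y)^s ≥ 15/16, while (1 + y)^s (1 - y)^s ≤
1. This is the total loss over all halvings. -/
theorem one_add_pow_le (s : ℕ) : (1 + 3 * (1 / (48 * s)) : ℝ) ^ s ≤ 16 / 15 := by
  rcases Nat.eq_zero_or_pos s with rfl | hs
  · norm_num
  have hs' : (1 : ℝ) ≤ s := by exact_mod_cast hs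
  set y : ℝ := 1 / (16 * s) with hy
  have hy0 : 0 < y := by positivity
  have hy1 : y ≤ 1 / 16 := by
    rw [hy]; apply one_div_le_one_div_of_le <;> linarith
  have h1 : 15 / 16 ≤ (1 - y) ^ s := by
    have := one_add_mul_le_pow (a := -y) (by linarith) s
    have h2 : (s : ℝ) * y = 1 / 16 := by rw [hy]; field_simp
    calc (15 / 16 : ℝ) = 1 + s * -y := by linarith
      _ ≤ _ := by simpa [sub_eq_add_neg] using this
  have h2 : (1 + y) ^ s * (1 - y) ^ s ≤ 1 := by
    rw [← mul_pow]
    exact pow_le_one₀ (by nlinarith) (by nlinarith)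
  have h3 : (1 + 3 * (1 / (48 * s)) : ℝ) = 1 + y := by rw [hy]; field_simp; ring
  rw [h3]
  have h4 : 0 < (1 + y) ^ s := by positivity
  nlinarith

/-- Number of classes of the defective colourings used for rounding coarse lists. -/
def classBound (M s : ℕ) : ℕ :=
  4 * (96 * s * Nat.clog 2 (4 * (96 * s * Nat.clog 2 M + 1) ^ 2) + 1) ^ 2

/-- Defect added by one step with the chosen `X`; two steps together add 1/(48s). -/
theorem clog_div_le {s : ℕ} (hs : 0 < s) (l : ℕ) :
    (l : ℝ) / (96 * s * l + 1 : ℕ) ≤ 1 / (96 * s) := by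
  have : (0 : ℝ) < s := by exact_mod_cast hs
  rw [div_le_div_iff₀ (by positivity) (by positivity)]
  push_cast
  nlinarith

/-- In three rounds, few classes with only a small fraction of the edge weight inside classes. -/
theorem exists_classes {wt : VertexState → VertexState → ℝ} (hwt : ∀ s t, 0 ≤ wt s t)
    (hinv : ∀ s t a b, wt { s with cls := a } { t with cls := b } = wt s t) (M : ℕ) {s : ℕ}
    (hs : 0 < s) :
    ∃ P : List (Step VertexState), P.length = 3 ∧ ∀ (V : Type) [Fintype V] (H : SimpleGraph V)
      (x : V → VertexState), (∀ v, (x v).base < M) →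
      (∀ v u, H.Adj v u → (x u).base ≠ (x v).base) →
      ∃ k : V → ℕ, (∀ v, k v < classBound M s) ∧ (∀ v, run H P x v = { x v with cls := k v }) ∧
        ∑ v, monoWeight H (fun v u => wt (x v) (x u)) k v
          ≤ 1 / (48 * s) * ∑ v, ∑ u ∈ H.nbr v, wt (x v) (x u) := by
  obtain ⟨K, hK, F, hF⟩ := exists_defectStep hwt M (X := 96 * s * Nat.clog 2 M + 1) (by omega)
  obtain ⟨K', hK', F', hF'⟩ := exists_defectStep hwt (4 * (96 * s * Nat.clog 2 M + 1) ^ 2)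
    (X := 96 * s * Nat.clog 2 (4 * (96 * s * Nat.clog 2 M + 1) ^ 2) + 1) (by omega)
  -- The proper colour `base` has defect zero. The first step leaves poly(s log M) colours, and the
  -- second replaces the dependence on log M by one on log(s log M).
  refine ⟨[fun s _ => { s with cls := s.base }, F, F'], rfl, fun V _ H x hx hp => ?_⟩
  set x₀ : V → VertexState := fun v => { x v with cls := (x v).base } with hx₀
  obtain ⟨k, hk, hk1, hk2⟩ := hF V H x₀ hx
  set x₁ : V → VertexState := fun v => { x v with cls := k v } with hx₁
  have hs₁ : step H F x₀ = x₁ := funext hk1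
  obtain ⟨k', g, g1, g2⟩ := hF' V H x₁ (fun v => (hk v).trans_le hK)
  refine ⟨k', fun v => (g v).trans_le hK', fun v => ?_, ?_⟩
  · change step H F' (step H F x₀) v = _
    rw [hs₁, g1]
  · have hw₀ : ∀ v u, wt (x₀ v) (x₀ u) = wt (x v) (x u) := fun v u => hinv _ _ _ _
    have hw₁ : ∀ v u, wt (x₁ v) (x₁ u) = wt (x v) (x u) := fun v u => hinv _ _ _ _
    simp only [hw₀] at hk2
    simp only [hw₁] at g2
    have hzero : ∀ v, monoWeight H (fun v u => wt (x v) (x u)) (fun v => (x₀ v).cls) v = 0 :=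
      fun v => sum_eq_zero fun u hu => if_neg (hp v u ((mem_nbr H).1 hu))
    rw [mul_sum]
    refine sum_le_sum fun v _ => ?_
    have hW : 0 ≤ ∑ u ∈ H.nbr v, wt (x v) (x u) := sum_nonneg fun u _ => hwt _ _
    have e1 := hk2 v
    have e2 := g2 v
    rw [hzero] at e1
    have e3 := mul_le_mul_of_nonneg_right (clog_div_le hs (Nat.clog 2 M)) hW
    have e4 := mul_le_mul_of_nonneg_right
      (clog_div_le hs (Nat.clog 2 (4 * (96 * s * Nat.clog 2 M + 1) ^ 2))) hW
    have e5 : (1 : ℝ) / (48 * s) = 1 / (96 * s) + 1 / (96 * s) := by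
      have : (s : ℝ) ≠ 0 := by exact_mod_cast hs.ne'
      field_simp; norm_num
    rw [e5, add_mul]
    refine e2.trans (add_le_add (e1.trans ?_) e4)
    rw [zero_add]
    exact e3

theorem overlap_range_self (s : ℕ) :
    overlap (fun _ => 1) (range (2 ^ s)) (range (2 ^ s)) = 1 / 2 ^ s := by
  simp [overlap]

/-- Few classes with an even smaller fraction of the edge weight inside classes. -/
theorem exists_coarse {wt : VertexState → VertexState → ℝ} (hwt : ∀ s t, 0 ≤ wt s t)
    (hsymm : ∀ s t, wt s t = wt t s)
    (hinv : ∀ s t A a B b,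
      wt { s with coarse := A, cls := a } { t with coarse := B, cls := b } = wt s t)
    (M : ℕ) {s : ℕ} (hs : 0 < s) :
    ∃ P : List (Step VertexState), P.length = s * (3 + classBound M s) + 2 ∧
      ∀ (V : Type) [Fintype V] (H : SimpleGraph V)
      (x : V → VertexState), (∀ v, (x v).base < M) →
      (∀ v u, H.Adj v u → (x u).base ≠ (x v).base) →
      ∃ (c : V → Finset ℕ) (k : V → ℕ), (∀ v, k v < 2 ^ s) ∧
        (∀ v, run H P x v = { x v with coarse := c v, cls := k v }) ∧
        ∑ v, monoWeight H (fun v u => wt (x v) (x u)) k v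
          ≤ 16 / 15 * (1 / 2 ^ s) * ∑ v, ∑ u ∈ H.nbr v, wt (x v) (x u) := by
  have hov : ∀ A B, 0 ≤ overlap (fun _ => 1) A B := overlap_nonneg fun _ => zero_le_one
  -- The weight contains the overlap of the current coarse lists, so its part inside classes is a
  -- fraction of the current cost.
  obtain ⟨P, hPl, hP⟩ := exists_classes
    (wt := fun s t => wt s t * overlap (fun _ => 1) s.coarse t.coarse)
    (fun s t => mul_nonneg (hwt s t) (hov _ _))
    (fun s t a b => by rw [hinv s t s.coarse a t.coarse b]) M hs
  -- The class will be the last survivor of a list of all `2 ^ s` classes. At the start the cost is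
  -- the expected weight inside random classes, a fraction `1 / 2 ^ s` of the total; at the end it
  -- is at least the actual weight inside classes.
  refine ⟨(fun t _ => { t with coarse := range (2 ^ s) }) ::
    (roundLists coarseField wt (fun _ => 1) (fun _ => 0) (classBound M s) P s ++
      [fun t _ => { t with cls := t.coarse.sup id }]), ?_, fun V _ H x hx hp => ?_⟩
  · simp [length_roundLists, hPl]
  set x₀ : V → VertexState := fun v => { x v with coarse := range (2 ^ s) } with hx₀
  set W : V → V → ℝ := fun v u => wt (x v) (x u) with hW
  obtain ⟨⟨c, k, hck⟩, hsub, hcard, hcost⟩ := roundLists_spec H coarseField (wt := wt)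
    (μ := fun _ => 1) (h := fun _ => 0) (fun _ => zero_le_one) (W := W)
    (fun u v => hsymm _ _) (fun u v => hwt _ _) (K := classBound M s) (P := P)
    (δ := 1 / (48 * s)) (by positivity)
    (Inv := fun y => ∃ (c : V → Finset ℕ) (k : V → ℕ),
      y = fun v => { x v with coarse := c v, cls := k v })
    (by rintro y L ⟨c, k, rfl⟩; exact ⟨L, k, rfl⟩)
    (by rintro y ⟨c, k, rfl⟩ u v; exact hinv _ _ _ _ _ _)
    (by
      rintro y ⟨c, k, rfl⟩
      obtain ⟨k', h1, h2, h3⟩ := hP V H (fun v => { x v with coarse := c v, cls := k v }) hx hp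
      have hrun := funext h2
      rw [hrun]
      refine ⟨⟨c, k', rfl⟩, fun v => rfl, h1, ?_⟩
      unfold monoWeight at h3
      simp only [hinv] at h3
      simpa [monoCost, cost, avg, coarseField, hW] using h3)
    s x₀ ⟨fun _ => range (2 ^ s), fun v => (x v).cls, rfl⟩
  have hc : ∀ v, #(c v) = 1 := fun v => by
    have := hcard v s (by simp [coarseField, x₀])
    rw [hck] at this
    simpa [coarseField] using this
  have hsub' : ∀ v, c v ⊆ range (2 ^ s) := fun v => by
    have := hsub v
    rw [hck] at this
    exact this
  have hsing : ∀ v, c v = {(c v).sup id} := fun v => by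
    obtain ⟨a, ha⟩ := card_eq_one.1 (hc v)
    simp [ha]
  refine ⟨c, fun v => (c v).sup id, fun v => ?_, fun v => ?_, ?_⟩
  · have := hsub' v
    rw [hsing v] at this
    simpa using this
  · rw [run_cons, run_append]
    change run H _ (run H _ x₀) v = _
    rw [hck]; rfl
  · rw [hck] at hcost
    have h1 : cost H W (fun _ => 1) (fun _ => 0) (fun v => coarseField.get (x₀ v))
        = 1 / 2 ^ s * ∑ v, ∑ u ∈ H.nbr v, W v u := by
      simp only [cost, avg, coarseField, x₀, overlap_range_self, sum_const_zero, zero_div,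
        zero_add, mul_sum]
      simp only [mul_comm]
    have h2 : ∑ v, monoWeight H W (fun v => (c v).sup id) v
        ≤ cost H W (fun _ => 1) (fun _ => 0) c := by
      unfold monoWeight cost
      refine sum_le_sum fun v _ => ?_
      simp only [avg, sum_const_zero, zero_div, zero_add]
      refine sum_le_sum fun u _ => ?_
      split_ifs with h
      · have : c u = c v := by rw [hsing u, hsing v, h]
        rw [this, overlap, inter_self, hc]
        simp [hc]
      · exact mul_nonneg (hwt _ _) (hov _ _)
    have hnn : 0 ≤ 1 / 2 ^ s * ∑ v, ∑ u ∈ H.nbr v, W v u :=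
      mul_nonneg (by positivity) (sum_nonneg fun v _ => sum_nonneg fun u _ => hwt _ _)
    calc _ ≤ cost H W (fun _ => 1) (fun _ => 0) c := h2
      _ ≤ _ := hcost
      _ ≤ 16 / 15 * (1 / 2 ^ s * ∑ v, ∑ u ∈ H.nbr v, W v u) := by
          rw [h1]
          exact mul_le_mul_of_nonneg_right (one_add_pow_le s) hnn
      _ = _ := by rw [mul_assoc]

/-- Indicator of the colours below `D`. -/
noncomputable def realColor (D c : ℕ) : ℝ := if c < D then 1 else 0

/-- Indicator of the dummy colours, which are those from `D` on. -/
noncomputable def dummyColor (D c : ℕ) : ℝ := if c < D then 0 else 1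

theorem realColor_nonneg (D c : ℕ) : 0 ≤ realColor D c := by
  unfold realColor; split_ifs <;> norm_num

theorem dummyColor_nonneg (D c : ℕ) : 0 ≤ dummyColor D c := by
  unfold dummyColor; split_ifs <;> norm_num

/-- Rounding the lists of candidates to single candidates. -/
theorem exists_roundList (D M : ℕ) {s r : ℕ} (hs : 0 < s) (hr : 0 < r) (hsr : 52 * s ≤ 2 ^ r) :
    ∃ P : List (Step VertexState), P.length = s * (r * (3 + classBound M r) + 2 + 2 ^ r) ∧
      ∀ (V : Type) [Fintype V] (H : SimpleGraph V)
      (x : V → VertexState), (∀ v, (x v).base < M) →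
      (∀ v u, H.Adj v u → (x u).base ≠ (x v).base) →
      ∃ (L c : V → Finset ℕ) (k : V → ℕ),
        (∀ v, run H P x v = { x v with list := L v, coarse := c v, cls := k v }) ∧
        (∀ v, L v ⊆ (x v).list) ∧ (∀ v, ∀ i ≤ s, #(x v).list = 2 ^ i → #(L v) = 1) ∧
        cost H (fun _ _ => 1) (realColor D) (dummyColor D) L
          ≤ 16 / 15 * cost H (fun _ _ => 1) (realColor D) (dummyColor D) (fun v => (x v).list) := by
  have hov : ∀ A B, 0 ≤ overlap (realColor D) A B := overlap_nonneg (realColor_nonneg D)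
  obtain ⟨P, hPl, hP⟩ := exists_coarse
    (wt := fun s t => overlap (realColor D) s.list t.list)
    (fun s t => hov _ _) (fun s t => overlap_comm _ _ _) (fun s t _ _ _ _ => rfl) M hr
  refine ⟨roundLists listField (fun _ _ => 1) (realColor D) (dummyColor D) (2 ^ r) P s, ?_,
    fun V _ H x hx hp => ?_⟩
  · rw [length_roundLists, hPl]
  have hcost0 : ∀ L, 0 ≤ cost H (fun _ _ => 1) (realColor D) (dummyColor D) L := fun L =>
    sum_nonneg fun v _ => add_nonneg (avg_nonneg (dummyColor_nonneg D) _)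
      (sum_nonneg fun u _ => by rw [one_mul]; exact hov _ _)
  obtain ⟨⟨L, c, k, hck⟩, hsub, hcard, hcost⟩ := roundLists_spec H listField
    (wt := fun _ _ => 1)
    (μ := realColor D) (h := dummyColor D) (realColor_nonneg D) (W := fun _ _ => 1)
    (fun u v => rfl) (fun u v => zero_le_one) (K := 2 ^ r) (P := P)
    (δ := 1 / (48 * s)) (by positivity)
    (Inv := fun y => ∃ (L c : V → Finset ℕ) (k : V → ℕ),
      y = fun v => { x v with list := L v, coarse := c v, cls := k v })
    (by rintro y L ⟨_, c, k, rfl⟩; exact ⟨L, c, k, rfl⟩)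
    (fun _ _ _ _ => rfl)
    (by
      rintro y ⟨L, c, k, rfl⟩
      obtain ⟨c', k', h1, h2, h3⟩ := hP V H
        (fun v => { x v with list := L v, coarse := c v, cls := k v }) hx hp
      have hrun := funext h2
      rw [hrun]
      refine ⟨⟨L, c', k', rfl⟩, fun v => rfl, h1, ?_⟩
      have e1 : monoCost H (fun _ _ => 1) (realColor D) k' L
          ≤ 16 / 15 * (1 / 2 ^ r) * ∑ v, ∑ u ∈ H.nbr v, overlap (realColor D) (L v) (L u) := by
        simpa [monoCost, monoWeight] using h3
      refine e1.trans ?_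
      have e2 : ∑ v, ∑ u ∈ H.nbr v, overlap (realColor D) (L v) (L u)
          ≤ cost H (fun _ _ => 1) (realColor D) (dummyColor D) L := by
        refine sum_le_sum fun v _ => ?_
        have := avg_nonneg (dummyColor_nonneg D) (L v)
        simpa using this
      -- This is where 52 comes from: 48 · 16/15 = 51.2.
      have e3 : (16 / 15 * (1 / 2 ^ r) : ℝ) ≤ 1 / (48 * s) := by
        have hs' : (0 : ℝ) < s := by exact_mod_cast hs
        have : (52 * s : ℝ) ≤ 2 ^ r := by exact_mod_cast hsr
        rw [div_mul_div_comm, div_le_div_iff₀ (by positivity) (by positivity)]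
        linarith
      exact mul_le_mul e3 e2 (sum_nonneg fun v _ => sum_nonneg fun u _ => hov _ _)
        (by positivity))
    s x ⟨fun v => (x v).list, fun v => (x v).coarse, fun v => (x v).cls, rfl⟩
  refine ⟨L, c, k, fun v => by rw [hck], fun v => ?_, fun v i hi hx => ?_, ?_⟩
  · have := hsub v
    rw [hck] at this
    exact this
  · have := hcard v i hx
    rw [Nat.sub_eq_zero_of_le hi, pow_zero] at this
    rw [hck] at this
    exact this
  · rw [hck] at hcost
    exact hcost.trans (mul_le_mul_of_nonneg_right (one_add_pow_le s) (hcost0 _))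

end ListRounding

/-! ### One colouring iteration, and the whole colouring. -/

namespace ListRounding

open Finset

variable {V : Type} [Fintype V] (H : SimpleGraph V)

open scoped Classical in
/-- The vertices without a final colour. -/
noncomputable def uncolored (x : V → VertexState) : Finset V :=
  univ.filter fun v => (x v).color = none

@[simp] theorem mem_uncolored (x : V → VertexState) (v : V) :
    v ∈ uncolored x ↔ (x v).color = none := by simp [uncolored]

/-- The final colours form a proper partial colouring with `D` colours. -/
def IsPartialColoring (D : ℕ) (x : V → VertexState) : Prop :=
  ∀ v c, (x v).color = some c → c < D ∧ ∀ u, H.Adj v u → (x u).color ≠ some c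

/-- A round in which each vertex without a final colour fills its list with a power of two of free
colours and three times as many dummy colours. -/
theorem exists_fillStep (D : ℕ) : ∃ F : Step VertexState, ∀ (V : Type) [Fintype V]
    (H : SimpleGraph V) (x : V → VertexState), (∀ v, #(H.nbr v) < D) →
    ∃ (A : V → Finset ℕ) (i : V → ℕ),
      (∀ v, step H F x v = { x v with
        list := if (x v).color = none then A v ∪ Ico D (D + 3 * 2 ^ i v) else ∅ }) ∧
      ∀ v, (x v).color = none → A v ⊆ range D ∧ #(A v) = 2 ^ i v ∧ i v ≤ Nat.clog 2 D ∧
        (∀ c ∈ A v, ∀ u, H.Adj v u → (x u).color ≠ some c) ∧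
        #{u ∈ H.nbr v | (x u).color = none} < 2 ^ (i v + 1) := by
  classical
  -- Sizes are powers of two so that repeated halving ends in exactly one candidate; with the
  -- dummies the size is `2 ^ (i + 2)`.
  have hpick : ∀ Q : Finset ℕ, ∃ A ⊆ Q, Q.Nonempty → #A = 2 ^ Nat.log 2 #Q := by
    intro Q
    rcases Q.eq_empty_or_nonempty with rfl | hQ
    · exact ⟨∅, Subset.rfl, by simp⟩
    · obtain ⟨A, hA, hAc⟩ := exists_subset_card_eq
        (Nat.pow_log_le_self 2 (card_pos.2 hQ).ne')
      exact ⟨A, hA, fun _ => hAc⟩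
  choose pick hpick1 hpick2 using hpick
  let pal : Multiset VertexState → Finset ℕ := fun ms =>
    (range D).filter fun c => ∀ t ∈ ms, t.color ≠ some c
  let fill : VertexState → Multiset VertexState → Finset ℕ := fun s ms =>
    if s.color = none then pick (pal ms) ∪ Ico D (D + 3 * 2 ^ Nat.log 2 #(pal ms)) else ∅
  refine ⟨fun s ms => { s with list := fill s ms }, ?_⟩
  intro V _ H x hdeg
  set Q : V → Finset ℕ := fun v => pal ((H.nbr v).val.map x) with hQ
  refine ⟨fun v => pick (Q v), fun v => Nat.log 2 #(Q v), fun v => rfl, fun v hv => ?_⟩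
  have hQv : Q v = (range D).filter fun c => ∀ u, H.Adj v u → (x u).color ≠ some c := by
    simp [hQ, pal]
  -- Each coloured neighbour blocks at most one of the `D` colours and the degree is below `D`, so
  -- free colours outnumber uncoloured neighbours.
  have hcard : #{u ∈ H.nbr v | (x u).color = none} < #(Q v) := by
    have h1 : range D \ ((H.nbr v).filter (fun u => ¬ (x u).color = none)).image
        (fun u => (x u).color.getD 0) ⊆ Q v := by
      intro c hc
      rw [hQv]
      simp only [mem_sdiff, mem_range, mem_image, mem_filter, mem_nbr, not_exists, not_and,
        and_imp] at hc ⊢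
      refine ⟨hc.1, fun u hu hcu => ?_⟩
      exact hc.2 u hu (by simp [hcu]) (by simp [hcu])
    have h2 := card_le_card h1
    have h3 := le_card_sdiff (((H.nbr v).filter (fun u => ¬ (x u).color = none)).image
        (fun u => (x u).color.getD 0)) (range D)
    have h4 : #(((H.nbr v).filter (fun u => ¬ (x u).color = none)).image
        (fun u => (x u).color.getD 0)) ≤ #((H.nbr v).filter (fun u => ¬ (x u).color = none)) :=
      card_image_le
    have h5 := card_filter_add_card_filter_not (s := H.nbr v) (fun u => (x u).color = none)
    have h6 := hdeg v
    rw [card_range] at h3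
    omega
  have hne : (Q v).Nonempty := card_pos.1 (by omega)
  have hQD : #(Q v) ≤ D := by
    rw [hQv]; exact (card_filter_le _ _).trans (by simp)
  refine ⟨(hpick1 _).trans (by rw [hQv]; exact filter_subset _ _), hpick2 _ hne, ?_, ?_, ?_⟩
  · refine (Nat.log_mono_right hQD).trans ?_
    exact Nat.log_le_clog 2 D
  · intro c hc
    have := hpick1 _ hc
    rw [hQv] at this
    exact (mem_filter.1 this).2
  · exact hcard.trans (Nat.lt_pow_succ_log_self one_lt_two _)

/-- A round in which each vertex whose only candidate is a colour that is no neighbour's only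
candidate takes that colour. -/
theorem exists_keepStep (D : ℕ) : ∃ F : Step VertexState, ∀ (V : Type) [Fintype V]
    (H : SimpleGraph V) (x : V → VertexState),
    (∀ v, (step H F x v).base = (x v).base) ∧
    ∀ v, (∃ c < D, (x v).list = {c} ∧ (∀ u, H.Adj v u → (x u).list ≠ {c}) ∧
        (step H F x v).color = some c) ∨
      ((∀ c < D, (x v).list = {c} → ∃ u, H.Adj v u ∧ (x u).list = {c}) ∧
        (step H F x v).color = (x v).color) := by
  classical
  refine ⟨fun s ms => if h : ∃ c < D, s.list = {c} ∧ ∀ t ∈ ms, t.list ≠ {c} then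
    { s with color := some h.choose } else s, ?_⟩
  intro V _ H x
  refine ⟨fun v => ?_, fun v => ?_⟩
  · unfold step
    dsimp only
    split_ifs <;> rfl
  · unfold step
    dsimp only
    split_ifs with h
    · left
      obtain ⟨h1, h2, h3⟩ := h.choose_spec
      exact ⟨h.choose, h1, h2, fun u hu => h3 _ (Multiset.mem_map_of_mem _ (by simpa using hu)), rfl⟩
    · right
      push Not at h
      refine ⟨fun c hc hl => ?_, rfl⟩
      obtain ⟨t, ht, htl⟩ := h c hc hl
      obtain ⟨u, hu, rfl⟩ := Multiset.mem_map.1 ht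
      exact ⟨u, by simpa using hu, htl⟩

open scoped Classical in
/-- The initial lists have cost at most `7 / 8` per vertex without a final colour. -/
theorem cost_fill_le {D : ℕ} {U : Finset V} {L A : V → Finset ℕ} {i : V → ℕ}
    (hL : ∀ v ∈ U, L v = A v ∪ Ico D (D + 3 * 2 ^ i v)) (hL' : ∀ v ∉ U, L v = ∅)
    (hA : ∀ v ∈ U, A v ⊆ range D) (hAc : ∀ v ∈ U, #(A v) = 2 ^ i v)
    (hdeg : ∀ v ∈ U, #{u ∈ H.nbr v | u ∈ U} ≤ 2 ^ (i v + 1)) :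
    cost H (fun _ _ => 1) (realColor D) (dummyColor D) L ≤ 7 / 8 * #U := by
  classical
  have hdisj : ∀ v ∈ U, Disjoint (A v) (Ico D (D + 3 * 2 ^ i v)) := fun v hv =>
    disjoint_left.2 fun c hc hc' => by
      have := mem_range.1 (hA v hv hc)
      have := (mem_Ico.1 hc').1
      omega
  have hLc : ∀ v ∈ U, #(L v) = 4 * 2 ^ i v := fun v hv => by
    rw [hL v hv, card_union_of_disjoint (hdisj v hv), hAc v hv, Nat.card_Ico]; omega
  have hreal : ∀ v ∈ U, ∀ c ∈ L v, c < D → c ∈ A v := fun v hv c hc hcD => by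
    rw [hL v hv, mem_union, mem_Ico] at hc
    rcases hc with h | h
    · exact h
    · omega
  have havg : ∀ v, avg (dummyColor D) (L v) = if v ∈ U then 3 / 4 else 0 := by
    intro v
    split_ifs with hv
    · unfold avg
      rw [hLc v hv, hL v hv, sum_union (hdisj v hv)]
      have h1 : ∑ c ∈ A v, dummyColor D c = 0 := sum_eq_zero fun c hc =>
        if_pos (mem_range.1 (hA v hv hc))
      have h2 : ∑ c ∈ Ico D (D + 3 * 2 ^ i v), dummyColor D c = 3 * 2 ^ i v := by
        have : ∀ c ∈ Ico D (D + 3 * 2 ^ i v), dummyColor D c = 1 := fun c hc =>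
          if_neg (not_lt.2 (mem_Ico.1 hc).1)
        rw [sum_congr rfl this]
        simp
      rw [h1, h2]
      push_cast
      field_simp
      norm_num
    · simp [hL' v hv, avg]
  -- An overlap is at most (2^i(v) + 2^i(u))/2 divided by 16 · 2^i(v) · 2^i(u), and so is charged to
  -- its two ends separately. The charges `T` at `v` sum to at most 2, which makes the edge cost at
  -- most (1/32)(2 + 2) = 1/8 per uncoloured vertex.
  set T : V → V → ℝ := fun v u => if v ∈ U ∧ u ∈ U then 1 / 2 ^ i v else 0 with hT
  have hsum : ∀ v ∈ U, ∀ u ∈ U, ∑ c ∈ L v ∩ L u, realColor D c ≤ 2 ^ i v := by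
    intro v hv u hu
    calc ∑ c ∈ L v ∩ L u, realColor D c ≤ ∑ c ∈ L v, realColor D c :=
          sum_le_sum_of_subset_of_nonneg inter_subset_left fun c _ _ => realColor_nonneg D c
      _ = #{c ∈ L v | c < D} := by simp [realColor]
      _ ≤ #(A v) := by
          exact_mod_cast card_le_card fun c hc =>
            hreal v hv c (mem_filter.1 hc).1 (mem_filter.1 hc).2
      _ = 2 ^ i v := by rw [hAc v hv]; push_cast; rfl
  have hov : ∀ v u, overlap (realColor D) (L v) (L u) ≤ 1 / 32 * (T v u + T u v) := by
    intro v u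
    by_cases hv : v ∈ U
    · by_cases hu : u ∈ U
      · have h1 := hsum v hv u hu
        have h2 := hsum u hu v hv
        rw [inter_comm] at h2
        simp only [hT, hv, hu, and_self, if_true]
        unfold overlap
        rw [hLc v hv, hLc u hu]
        have p1 : (0 : ℝ) < 2 ^ i v := by positivity
        have p2 : (0 : ℝ) < 2 ^ i u := by positivity
        push_cast
        have : (1 / 32 * (1 / 2 ^ i v + 1 / 2 ^ i u) : ℝ)
          = ((2 ^ i v + 2 ^ i u) / 2) / (4 * 2 ^ i v * (4 * 2 ^ i u)) := by
          field_simp; ring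
        rw [this]
        gcongr
        linarith
      · simp [hT, hu, hL' u hu, overlap]
    · simp [hT, hv, hL' v hv, overlap]
  have hTs : ∀ v, ∑ u ∈ H.nbr v, T v u ≤ if v ∈ U then 2 else 0 := by
    intro v
    split_ifs with hv
    · simp only [hT, hv, true_and]
      rw [← sum_filter, sum_const, nsmul_eq_mul, mul_one_div, div_le_iff₀ (by positivity)]
      have := hdeg v hv
      rw [pow_succ'] at this
      exact_mod_cast this
    · simp [hT, hv]
  have hTsum : ∑ v, ∑ u ∈ H.nbr v, T v u ≤ 2 * #U := by
    refine (sum_le_sum fun v _ => hTs v).trans ?_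
    simp [mul_comm]
  have hovsum : ∑ v, ∑ u ∈ H.nbr v, overlap (realColor D) (L v) (L u) ≤ 1 / 8 * #U := by
    calc _ ≤ ∑ v, ∑ u ∈ H.nbr v, 1 / 32 * (T v u + T u v) :=
          sum_le_sum fun v _ => sum_le_sum fun u _ => hov v u
      _ = 1 / 16 * ∑ v, ∑ u ∈ H.nbr v, T v u := by
          simp only [← mul_sum, sum_add_distrib]
          rw [← sum_nbr_comm H T]; ring
      _ ≤ _ := by linarith
  unfold cost
  simp only [one_mul]
  rw [sum_add_distrib]
  have : ∑ v, avg (dummyColor D) (L v) = 3 / 4 * #U := by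
    simp [havg, mul_comm]
  linarith

/-- Number of rounds in which a constant fraction of the vertices gets final colours. -/
def iterLength (D M : ℕ) : ℕ :=
  let s := Nat.clog 2 D + 2
  let r := Nat.clog 2 (52 * s)
  s * (r * (3 + classBound M r) + 2 + 2 ^ r) + 2

/-- When all candidates are single, a vertex that stays uncoloured has a dummy or shares its
candidate with a neighbour, so it pays at least one. Their number is thus at most the final cost,
which is at most 16/15 · 7/8 = 14/15 per vertex uncoloured before. -/
theorem exists_iteration (D M : ℕ) : ∃ P : List (Step VertexState), P.length = iterLength D M ∧
    ∀ (V : Type) [Fintype V] (H : SimpleGraph V) (x : V → VertexState),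
      (∀ v, #(H.nbr v) < D) → (∀ v, (x v).base < M) →
      (∀ v u, H.Adj v u → (x u).base ≠ (x v).base) → IsPartialColoring H D x →
      (∀ v, (run H P x v).base = (x v).base) ∧ IsPartialColoring H D (run H P x) ∧
        (#(uncolored (run H P x)) : ℝ) ≤ 14 / 15 * #(uncolored x) := by
  classical
  obtain ⟨F, hF⟩ := exists_fillStep D
  obtain ⟨F', hF'⟩ := exists_keepStep D
  -- Lists have size `2 ^ (i + 2)` with `i ≤ Nat.clog 2 D`, so this many halvings suffice.
  obtain ⟨P, hPl, hP⟩ := exists_roundList D M (s := Nat.clog 2 D + 2)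
    (r := Nat.clog 2 (52 * (Nat.clog 2 D + 2))) (by omega)
    (Nat.clog_pos one_lt_two (by omega)) (Nat.le_pow_clog one_lt_two _)
  refine ⟨F :: (P ++ [F']), by simp [hPl, iterLength], fun V _ H x hdeg hx hp hpc => ?_⟩
  obtain ⟨A, i, hA1, hA2⟩ := hF V H x hdeg
  set x₁ := step H F x with hx₁
  have hb₁ : ∀ v, (x₁ v).base = (x v).base := fun v => by rw [hA1]
  have hc₁ : ∀ v, (x₁ v).color = (x v).color := fun v => by rw [hA1]
  have hl₁ : ∀ v, (x v).color = none → (x₁ v).list = A v ∪ Ico D (D + 3 * 2 ^ i v) :=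
    fun v hv => by rw [hA1]; simp [hv]
  have hl₁' : ∀ v, (x v).color ≠ none → (x₁ v).list = ∅ :=
    fun v hv => by rw [hA1]; simp [hv]
  obtain ⟨L, c, k, h1, h2, h3, h4⟩ := hP V H x₁ (by simpa [hb₁] using hx) (by simpa [hb₁] using hp)
  set x₂ := run H P x₁ with hx₂
  have hb₂ : ∀ v, (x₂ v).base = (x v).base := fun v => by rw [h1]; exact hb₁ v
  have hc₂ : ∀ v, (x₂ v).color = (x v).color := fun v => by rw [h1]; exact hc₁ v
  have hl₂ : ∀ v, (x₂ v).list = L v := fun v => by rw [h1]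
  have hrun : run H (F :: (P ++ [F'])) x = step H F' x₂ := by
    rw [run_cons, run_append]; rfl
  obtain ⟨g1, g2⟩ := hF' V H x₂
  rw [hrun]
  set y := step H F' x₂ with hy
  simp only [hl₂, hc₂, hb₂] at g1 g2
  have hnone : ∀ v a, L v = {a} → (x v).color = none := fun v a hv => by
    by_contra hcon
    have := h2 v
    rw [hl₁' v hcon, hv] at this
    simp at this
  have hfree : ∀ v a, a < D → L v = {a} → ∀ u, H.Adj v u → (x u).color ≠ some a :=
    fun v a ha hv => by
      have hn := hnone v a hv
      have := h2 v
      rw [hl₁ v hn, hv, singleton_subset_iff, mem_union, mem_Ico] at this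
      exact (hA2 v hn).2.2.2.1 a (this.resolve_right (by omega))
  have hcol : ∀ v a, (y v).color = some a → (x v).color = some a ∨
      (a < D ∧ L v = {a} ∧ ∀ u, H.Adj v u → L u ≠ {a}) := fun v a hv => by
    rcases g2 v with ⟨b, hb, hb1, hb2, hb3⟩ | ⟨-, hb⟩
    · rw [hb3, Option.some.injEq] at hv
      subst hv
      exact Or.inr ⟨hb, hb1, hb2⟩
    · exact Or.inl (hb ▸ hv)
  refine ⟨g1, fun v a hv => ?_, ?_⟩
  · rcases hcol v a hv with h | ⟨ha, hLa, hLu⟩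
    · refine ⟨(hpc v a h).1, fun u hu hu' => ?_⟩
      rcases hcol u a hu' with h' | ⟨ha, hLa, -⟩
      · exact (hpc v a h).2 u hu h'
      · exact hfree u a ha hLa v hu.symm h
    · refine ⟨ha, fun u hu hu' => ?_⟩
      rcases hcol u a hu' with h' | ⟨-, hLa', -⟩
      · exact hfree v a ha hLa u hu h'
      · exact hLu u hu hLa'
  · have hstart : cost H (fun _ _ => 1) (realColor D) (dummyColor D) (fun v => (x₁ v).list)
        ≤ 7 / 8 * #(uncolored x) := by
      apply cost_fill_le H (A := A) (i := i)
      · intro v hv; exact hl₁ v (by simpa using hv)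
      · intro v hv; exact hl₁' v (by simpa using hv)
      · intro v hv; exact (hA2 v (by simpa using hv)).1
      · intro v hv; exact (hA2 v (by simpa using hv)).2.1
      · intro v hv
        have := (hA2 v (by simpa using hv)).2.2.2.2.le
        simpa using this
    have hend : (#(uncolored y) : ℝ) ≤ cost H (fun _ _ => 1) (realColor D) (dummyColor D) L := by
      have hov : ∀ A B, 0 ≤ overlap (realColor D) A B := overlap_nonneg (realColor_nonneg D)
      have : (#(uncolored y) : ℝ) = ∑ v, if (y v).color = none then 1 else 0 := by
        simp [uncolored]
      rw [this]
      unfold cost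
      refine sum_le_sum fun v _ => ?_
      simp only [one_mul]
      have n1 := avg_nonneg (dummyColor_nonneg D) (L v)
      have n2 : 0 ≤ ∑ u ∈ H.nbr v, overlap (realColor D) (L v) (L u) :=
        sum_nonneg fun u _ => hov _ _
      split_ifs with hv
      · rcases g2 v with ⟨b, -, -, -, hb⟩ | ⟨hb, hb'⟩
        · rw [hv] at hb; cases hb
        · have hn : (x v).color = none := by rw [← hb', hv]
          have hcard : #(L v) = 1 := by
            refine h3 v (i v + 2) (by have := (hA2 v hn).2.2.1; omega) ?_
            rw [hl₁ v hn, card_union_of_disjoint, (hA2 v hn).2.1, Nat.card_Ico, pow_add]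
            · omega
            · refine disjoint_left.2 fun c hc hc' => ?_
              have := mem_range.1 ((hA2 v hn).1 hc)
              have := (mem_Ico.1 hc').1
              omega
          obtain ⟨a, ha⟩ := card_eq_one.1 hcard
          by_cases haD : a < D
          · obtain ⟨u, hu, hLu⟩ := hb a haD ha
            have : overlap (realColor D) (L v) (L u) ≤
                ∑ u ∈ H.nbr v, overlap (realColor D) (L v) (L u) :=
              single_le_sum (f := fun u => overlap (realColor D) (L v) (L u))
                (fun u _ => hov _ _) ((mem_nbr H).2 hu)
            have h1 : overlap (realColor D) (L v) (L u) = 1 := by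
              rw [ha, hLu, overlap, inter_self, sum_singleton, realColor, if_pos haD]
              simp
            linarith
          · have : avg (dummyColor D) (L v) = 1 := by
              simp [ha, avg, dummyColor, haD]
            linarith
      · linarith
    linarith

/-- Bound for the number of rounds of the colouring algorithm. -/
def totalLength (D m : ℕ) : ℕ := m + 1 + (11 * m + 1) * iterLength D ((30 * D) ^ 4)

/-- Distinct identifiers below `2 ^ m` also bound the number of vertices. As (14/15)^11 ≤ 1/2, after
`11 * m + 1` iterations fewer than one vertex is uncoloured. -/
theorem exists_coloring {D : ℕ} (hD : 0 < D) (m : ℕ) :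
    ∃ P : List (Step VertexState), P.length ≤ totalLength D m ∧
    ∀ (V : Type) [Fintype V] (H : SimpleGraph V) (x : V → VertexState),
      (∀ v, #(H.nbr v) < D) → (∀ v, (x v).cls < 2 ^ m) → (fun v => (x v).cls).Injective →
      (∀ v, (x v).color = none) →
      ∀ v, ∃ c < D, (run H P x v).color = some c ∧
        ∀ u, H.Adj v u → (run H P x u).color ≠ some c := by
  obtain ⟨P, hPl, hP⟩ := exists_baseColoring hD m _ le_rfl
  obtain ⟨Q, hQl, hQ⟩ := exists_iteration D ((30 * D) ^ 4)
  refine ⟨P ++ (fun s _ => { s with base := s.cls }) :: (List.replicate (11 * m + 1) Q).flatten,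
    ?_, fun V _ H x hdeg hx hinj hnone => ?_⟩
  · simp [totalLength, hQl]
    omega
  obtain ⟨k, hk1, hk2, hk3⟩ := hP V H x hdeg hx fun v u huv h => huv.ne' (hinj h)
  rw [run_append, run_cons]
  set x₀ := step H (fun s _ => { s with base := s.cls }) (run H P x) with hx₀
  have hx₀' : ∀ v, x₀ v = { x v with base := k v, cls := k v } := fun v => by
    rw [hx₀]; unfold step; rw [hk2]
  have key : ∀ t, (∀ v, (run H (List.replicate t Q).flatten x₀ v).base = k v) ∧
      IsPartialColoring H D (run H (List.replicate t Q).flatten x₀) ∧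
      (#(uncolored (run H (List.replicate t Q).flatten x₀)) : ℝ)
        ≤ (14 / 15) ^ t * Fintype.card V := by
    intro t
    induction t with
    | zero =>
      refine ⟨fun v => by simp [hx₀'], fun v c hc => ?_, ?_⟩
      · simp [hx₀', hnone] at hc
      · simp only [List.replicate_zero, List.flatten_nil, run_nil, pow_zero, one_mul]
        exact_mod_cast card_le_univ _
    | succ t ih =>
      obtain ⟨h1, h2, h3⟩ := ih
      have : run H (List.replicate (t + 1) Q).flatten x₀
          = run H Q (run H (List.replicate t Q).flatten x₀) := by
        rw [List.replicate_succ', List.flatten_append, run_append]; simp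
      rw [this]
      obtain ⟨g1, g2, g3⟩ := hQ V H _ hdeg (fun v => by rw [h1]; exact hk1 v)
        (fun v u huv => by rw [h1, h1]; exact hk3 v u huv) h2
      refine ⟨fun v => (g1 v).trans (h1 v), g2, g3.trans ?_⟩
      rw [pow_succ']
      linarith
  obtain ⟨-, h2, h3⟩ := key (11 * m + 1)
  have hcard : Fintype.card V ≤ 2 ^ m := by
    have := Fintype.card_le_of_injective (fun v => (⟨(x v).cls, hx v⟩ : Fin (2 ^ m)))
      (fun u v h => hinj (by simpa using h))
    simpa using this
  have hzero : uncolored (run H (List.replicate (11 * m + 1) Q).flatten x₀) = ∅ := by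
    rw [← card_eq_zero, ← Nat.lt_one_iff]
    have h4 : ((14 / 15 : ℝ)) ^ (11 * m + 1) * Fintype.card V < 1 := by
      have hc : (Fintype.card V : ℝ) ≤ 2 ^ m := by exact_mod_cast hcard
      have h5 : ((14 / 15 : ℝ) ^ 11) ^ m * 2 ^ m ≤ 1 := by
        rw [← mul_pow]
        exact pow_le_one₀ (by positivity) (by norm_num)
      calc ((14 / 15 : ℝ)) ^ (11 * m + 1) * Fintype.card V
          ≤ ((14 / 15 : ℝ)) ^ (11 * m + 1) * 2 ^ m := by gcongr
        _ = 14 / 15 * (((14 / 15 : ℝ) ^ 11) ^ m * 2 ^ m) := by rw [pow_succ, pow_mul]; ring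
        _ < 1 := by linarith
    exact_mod_cast h3.trans_lt h4
  intro v
  rcases hv : (run H (List.replicate (11 * m + 1) Q).flatten x₀ v).color with _ | c
  · have : v ∈ uncolored (run H (List.replicate (11 * m + 1) Q).flatten x₀) := by simpa using hv
    rw [hzero] at this
    simp at this
  · exact ⟨c, (h2 v c hv).1, rfl, (h2 v c hv).2⟩

end ListRounding

/-! ### Simulating the line graph in the network. -/

namespace ListRounding

open Finset

section Simulation

variable {S : Type}

/-- State of a node that simulates an algorithm on the line graph: its identifier, whether it
knows its incident edges already, the rounds still to be simulated, and the states of its incident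
edges. -/
structure SimState (S : Type) where
  ident : ℕ
  ready : Bool
  pending : List (Step S)
  edge : ℕ → S

/-- The identifier of an edge whose endpoints have identifiers `a` and `b`. -/
def pairIdent (a b : ℕ) : ℕ := Nat.pair (min a b) (max a b)

theorem pairIdent_comm (a b : ℕ) : pairIdent a b = pairIdent b a := by
  simp [pairIdent, min_comm, max_comm]

/-- The states of the edges at the ports other than `i`. -/
def otherEdges (d : ℕ) (s : ℕ → S) (i : Fin d) : Multiset S :=
  (univ.erase i).val.map fun k : Fin d => s k

/-- One round at a node of degree `d`: the first round exchanges identifiers, each further round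
simulates a round of the line graph at all incident edges. -/
noncomputable def simReceive (start : ℕ → S) (d : ℕ) (s : SimState S)
    (msg : Fin d → ℕ × Multiset S) : SimState S :=
  if s.ready then
    match s.pending with
    | [] => s
    | F :: P =>
      { s with
        pending := P
        edge := fun i => if h : i < d then
          F (s.edge i) (otherEdges d s.edge ⟨i, h⟩ + (msg ⟨i, h⟩).2) else s.edge i }
  else
    { s with
      ready := true
      edge := fun i => if h : i < d then start (pairIdent s.ident (msg ⟨i, h⟩).1) else s.edge i }

/-- The `LOCAL` algorithm that simulates the rounds `prog n Δ` on the line graph. -/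
noncomputable def simulation (prog : ℕ → ℕ → List (Step S)) (start : ℕ → S) (out : S → ℕ) :
    LocalAlgorithm where
  State := SimState S
  Msg := ℕ × Multiset S
  rounds n Δ _ := (prog n Δ).length + 1
  init n Δ _ ident _ := ⟨ident, false, prog n Δ, fun _ => start 0⟩
  send d s i := (s.ident, otherEdges d s.edge i)
  receive := simReceive start
  output _ s i := out (s.edge i)

variable {V : Type} [Fintype V] {G : SimpleGraph V} [DecidableRel G.Adj]

/-- The edge at a port. -/
def edgeAt (port : LocalAlgorithm.PortNumbering G) (v : V) (i : Fin (G.degree v)) : G.edgeSet :=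
  ⟨s(v, (port v i : V)), (port v i).2⟩

/-- The port at the other end of an edge. -/
def backPort (port : LocalAlgorithm.PortNumbering G) (v : V) (i : Fin (G.degree v)) :
    Fin (G.degree (port v i)) :=
  (port (port v i)).symm ⟨v, SimpleGraph.Adj.symm (port v i).2⟩

variable (port : LocalAlgorithm.PortNumbering G)

theorem edgeAt_injective (v : V) : Function.Injective (edgeAt port v) := by
  intro i j h
  have h1 : s(v, (port v i : V)) = s(v, (port v j : V)) := congrArg Subtype.val h
  exact (port v).injective (Subtype.ext (Sym2.congr_right.1 h1))

theorem exists_edgeAt {v : V} {e : G.edgeSet} (h : v ∈ (e : Sym2 V)) : ∃ i, edgeAt port v i = e := by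
  obtain ⟨e, he⟩ := e
  obtain ⟨w, rfl⟩ := Sym2.mem_iff_exists.1 h
  exact ⟨(port v).symm ⟨w, he⟩, Subtype.ext (by simp [edgeAt])⟩

theorem edgeAt_backPort (v : V) (i : Fin (G.degree v)) :
    edgeAt port (port v i) (backPort port v i) = edgeAt port v i := by
  apply Subtype.ext
  simp [edgeAt, backPort, Sym2.eq_swap]

theorem mem_edgeAt (v : V) (i : Fin (G.degree v)) : v ∈ (edgeAt port v i : Sym2 V) := by
  simp [edgeAt]

variable [Fintype G.edgeSet]

/-- Only the edge itself contains both of its ends, so the other edges at the two ends form a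
disjoint union. One end knows the first part, and a single message supplies the second. -/
theorem nbr_edgeAt_val (v : V) (i : Fin (G.degree v)) :
    (G.lineGraph.nbr (edgeAt port v i)).val = (univ.erase i).val.map (edgeAt port v) +
      (univ.erase (backPort port v i)).val.map (edgeAt port (port v i)) := by
  classical
  have hdisj : Disjoint ((univ.erase i).map ⟨edgeAt port v, edgeAt_injective port v⟩)
      ((univ.erase (backPort port v i)).map
        ⟨edgeAt port (port v i), edgeAt_injective port (port v i)⟩) := by
    rw [disjoint_left]
    intro e he he'
    simp only [mem_map, mem_erase, mem_univ, and_true, Function.Embedding.coeFn_mk] at he he'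
    obtain ⟨k, hk, rfl⟩ := he
    obtain ⟨l, -, hl⟩ := he'
    have hne : v ≠ port v i := (port v i).2.ne
    have := (Sym2.mem_and_mem_iff hne).1
      ⟨mem_edgeAt port v k, hl ▸ mem_edgeAt port (port v i) l⟩
    exact hk (edgeAt_injective port v (Subtype.ext this))
  have : G.lineGraph.nbr (edgeAt port v i) = Finset.disjUnion _ _ hdisj := by
    ext e
    simp only [mem_nbr, SimpleGraph.lineGraph_adj_iff_exists, mem_disjUnion, mem_map, mem_erase,
      mem_univ, and_true, Function.Embedding.coeFn_mk]
    constructor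
    · rintro ⟨hne, w, hw, hwe⟩
      obtain ⟨l, rfl⟩ := exists_edgeAt port hwe
      simp only [edgeAt, Sym2.mem_iff] at hw
      rcases hw with rfl | rfl
      · exact Or.inl ⟨l, fun h => hne (by rw [h]), rfl⟩
      · refine Or.inr ⟨l, fun h => hne ?_, rfl⟩
        rw [h, edgeAt_backPort]
    · rintro (⟨l, hl, rfl⟩ | ⟨l, hl, rfl⟩)
      · exact ⟨fun h => hl (edgeAt_injective port v h.symm), v, mem_edgeAt port v i,
          mem_edgeAt port v l⟩
      · rw [← edgeAt_backPort]
        exact ⟨fun h => hl (edgeAt_injective port _ h.symm), _, mem_edgeAt port _ _,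
          mem_edgeAt port _ l⟩
  rw [this]
  rfl

theorem card_nbr_lineGraph_lt (hΔ : 0 < G.maxDegree) (e : G.edgeSet) :
    #(G.lineGraph.nbr e) < 2 * G.maxDegree := by
  obtain ⟨v, hv⟩ : ∃ v, v ∈ (e : Sym2 V) := ⟨_, Sym2.out_fst_mem _⟩
  let port : LocalAlgorithm.PortNumbering G := fun v =>
    Fintype.equivOfCardEq ((Fintype.card_fin _).trans (G.card_neighborSet_eq_degree v).symm)
  obtain ⟨i, rfl⟩ := exists_edgeAt port hv
  rw [card_def, nbr_edgeAt_val]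
  have h1 := G.degree_le_maxDegree v
  have h2 := G.degree_le_maxDegree (port v i)
  simp
  omega

/-- The initial configuration of the line graph. -/
def startConfig (start : ℕ → S) (ident : V → ℕ) (e : G.edgeSet) : S :=
  start (Sym2.lift ⟨fun u v => pairIdent (ident u) (ident v), fun _ _ => pairIdent_comm _ _⟩ e.1)

/-- Invariant of the simulation: both ends of an edge hold its state in the run on the line graph.
The simulation lags one round behind, because the first round exchanges identifiers. -/
theorem stateAfter_simulation (prog : ℕ → ℕ → List (Step S)) (start : ℕ → S) (out : S → ℕ)
    (ident : V → ℕ) (ε : ℝ) (t : ℕ) (ht : t ≤ (prog (Fintype.card V) G.maxDegree).length) (v : V) :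
    ∃ edge : ℕ → S,
      (simulation prog start out).stateAfter ident port ε (t + 1) v =
        ⟨ident v, true, (prog (Fintype.card V) G.maxDegree).drop t, edge⟩ ∧
      ∀ i : Fin (G.degree v), edge i = run G.lineGraph
        ((prog (Fintype.card V) G.maxDegree).take t) (startConfig start ident) (edgeAt port v i) := by
  induction t generalizing v with
  | zero =>
    refine ⟨fun i => if h : i < G.degree v then
      start (pairIdent (ident v) (ident (port v ⟨i, h⟩))) else start 0, rfl, fun i => ?_⟩
    simp [startConfig, edgeAt]
  | succ t ih =>
    set P := prog (Fintype.card V) G.maxDegree with hP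
    choose edge hs he using ih (by omega)
    have hdrop : P.drop t = P[t] :: P.drop (t + 1) := List.drop_eq_getElem_cons ht
    refine ⟨fun i => if h : i < G.degree v then P[t] (edge v i)
      (otherEdges (G.degree v) (edge v) ⟨i, h⟩ +
        otherEdges (G.degree (port v ⟨i, h⟩)) (edge (port v ⟨i, h⟩)) (backPort port v ⟨i, h⟩))
      else edge v i, ?_, fun i => ?_⟩
    · rw [LocalAlgorithm.stateAfter]
      simp only [hs]
      change simReceive start (G.degree v) ⟨ident v, true, P.drop t, edge v⟩ (fun i =>
        (ident (port v i), otherEdges _ (edge (port v i)) (backPort port v i))) = _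
      rw [simReceive, if_pos rfl]
      simp only [hdrop]
    · simp only [Fin.is_lt, dif_pos, Fin.eta]
      rw [← List.take_append_getElem ht, run_append, run_cons, run_nil, step, nbr_edgeAt_val, he,
        Multiset.map_add, Multiset.map_map, Multiset.map_map]
      simp only [otherEdges, he]
      rfl

theorem finalOutput_simulation (prog : ℕ → ℕ → List (Step S)) (start : ℕ → S) (out : S → ℕ)
    (ident : V → ℕ) (ε : ℝ) (v : V) (i : Fin (G.degree v)) :
    (simulation prog start out).finalOutput ident port ε v i =
      out (run G.lineGraph (prog (Fintype.card V) G.maxDegree) (startConfig start ident)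
        (edgeAt port v i)) := by
  obtain ⟨edge, h1, h2⟩ := stateAfter_simulation port prog start out ident ε _ le_rfl v
  rw [List.take_length] at h2
  rw [← h2 i]
  change out (SimState.edge ((simulation prog start out).stateAfter ident port ε
    ((prog (Fintype.card V) G.maxDegree).length + 1) v) i) = _
  rw [h1]

end Simulation

variable {V : Type} {G : SimpleGraph V}

/-- The smaller and the larger identifier of the ends determine the edge. -/
theorem startConfig_ident_injective {ident : V → ℕ} (h : Function.Injective ident) :
    Function.Injective fun e : G.edgeSet => startConfig id ident e := by
  rintro ⟨e, he⟩ ⟨e', he'⟩ hee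
  induction e with | _ a b
  induction e' with | _ a' b'
  simp only [startConfig, Sym2.lift_mk, id, pairIdent, Nat.pair_eq_pair] at hee
  apply Subtype.ext
  simp only [Sym2.eq_iff]
  rcases le_total (ident a) (ident b) with h1 | h1 <;>
    rcases le_total (ident a') (ident b') with h2 | h2 <;>
    simp only [h1, h2, min_eq_left, min_eq_right, max_eq_left, max_eq_right] at hee
  · exact Or.inl ⟨h hee.1, h hee.2⟩
  · exact Or.inr ⟨h hee.1, h hee.2⟩
  · exact Or.inr ⟨h hee.2, h hee.1⟩
  · exact Or.inl ⟨h hee.2, h hee.1⟩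

theorem startConfig_ident_lt {ident : V → ℕ} {B : ℕ} (h : ∀ v, ident v < B) (e : G.edgeSet) :
    startConfig id ident e < B ^ 2 := by
  rcases e with ⟨e, he⟩
  induction e with | _ a b
  simp only [startConfig, Sym2.lift_mk, id, pairIdent]
  refine (Nat.pair_lt_max_add_one_sq _ _).trans_le (Nat.pow_le_pow_left ?_ 2)
  have := h a
  have := h b
  omega

end ListRounding

/-! ### Counting rounds. -/

namespace ListRounding

open Finset

theorem clog_mul_le {a b i j : ℕ} (ha : a ≤ 2 ^ i) (hb : Nat.clog 2 b ≤ j) :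
    Nat.clog 2 (a * b) ≤ i + j := by
  apply Nat.clog_le_of_le_pow
  rw [pow_add]
  exact Nat.mul_le_mul ha ((Nat.clog_le_iff_le_pow one_lt_two).1 hb)

/-- With l = log D and k = log l + 8, both the number of halvings and `2 ^ r` are O(l). The bound on
classes for the coarse rounding is O(k⁴), so that rounding takes O(k⁵) = O(2^k) = O(l) rounds. Hence
each halving takes O(l) rounds. -/
theorem iterLength_le {D : ℕ} (hD : 1 < D) :
    iterLength D ((30 * D) ^ 4) ≤ 10 ^ 14 * Nat.clog 2 D ^ 2 := by
  set l := Nat.clog 2 D with hl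
  have hl1 : 0 < l := Nat.clog_pos one_lt_two hD
  -- The 8 covers the constant in 52(l + 2) ≤ 156l ≤ 2⁸l, so that `r ≤ k`.
  set k := Nat.clog 2 l + 8 with hk
  have hk8 : 8 ≤ k := by omega
  have hlk : l ≤ 2 ^ (k - 8) := by
    have : k - 8 = Nat.clog 2 l := by omega
    rw [this]; exact Nat.le_pow_clog one_lt_two _
  set r := Nat.clog 2 (52 * (l + 2)) with hr
  have hrk : r ≤ k := by
    have h1 : Nat.clog 2 (156 * l) ≤ 8 + Nat.clog 2 l :=
      clog_mul_le (by norm_num) le_rfl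
    have h2 : r ≤ Nat.clog 2 (156 * l) := Nat.clog_mono_right 2 (by omega)
    omega
  have h2r : 2 ^ r ≤ 312 * l := by
    have h1 := Nat.pow_pred_clog_lt_self one_lt_two (x := 52 * (l + 2)) (by omega)
    have h2 : 0 < r := Nat.clog_pos one_lt_two (by omega)
    have h3 : 2 ^ r = 2 * 2 ^ r.pred := by
      rw [← pow_succ', ← Nat.succ_eq_add_one, Nat.succ_pred_eq_of_pos h2]
    rw [← hr] at h1
    omega
  have h2k : 2 ^ k ≤ 512 * l := by
    rcases Nat.lt_or_ge 1 l with h | h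
    · have h1 := Nat.pow_pred_clog_lt_self one_lt_two h
      have h2 : 0 < Nat.clog 2 l := Nat.clog_pos one_lt_two h
      have h3 : 2 ^ k = 512 * 2 ^ (Nat.clog 2 l).pred := by
        have : k = 9 + (Nat.clog 2 l).pred := by
          have := Nat.succ_pred_eq_of_pos h2
          omega
        rw [this, pow_add]; norm_num
      omega
    · have : l = 1 := by omega
      simp [hk, this]
  have hM : Nat.clog 2 ((30 * D) ^ 4) ≤ 24 * l := by
    apply Nat.clog_le_of_le_pow
    have h1 : 30 * D ≤ 2 ^ (5 + l) := by
      rw [pow_add]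
      exact Nat.mul_le_mul (by norm_num) (Nat.le_pow_clog one_lt_two _)
    calc (30 * D) ^ 4 ≤ (2 ^ (5 + l)) ^ 4 := Nat.pow_le_pow_left h1 4
      _ = 2 ^ ((5 + l) * 4) := by rw [← pow_mul]
      _ ≤ 2 ^ (24 * l) := Nat.pow_le_pow_right two_pos (by omega)
  have hinner : Nat.clog 2 (4 * (96 * r * Nat.clog 2 ((30 * D) ^ 4) + 1) ^ 2) ≤ 8 * k := by
    apply Nat.clog_le_of_le_pow
    have hkk : k ≤ 2 ^ k := Nat.lt_two_pow_self.le
    have h1 : 96 * r * Nat.clog 2 ((30 * D) ^ 4) + 1 ≤ 2 ^ 12 * (k * l) := by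
      have h2 : r * Nat.clog 2 ((30 * D) ^ 4) ≤ k * (24 * l) := Nat.mul_le_mul hrk hM
      have h3 : 0 < k * l := by positivity
      have h4 : k * (24 * l) = 24 * (k * l) := by ring
      rw [mul_assoc]
      omega
    have h5 : 2 ^ 12 * (k * l) ≤ 2 ^ (2 * k + 4) := by
      calc 2 ^ 12 * (k * l) ≤ 2 ^ 12 * (2 ^ k * 2 ^ (k - 8)) := by gcongr
        _ = 2 ^ (2 * k + 4) := by rw [← pow_add, ← pow_add]; congr 1; omega
    calc 4 * (96 * r * Nat.clog 2 ((30 * D) ^ 4) + 1) ^ 2 ≤ 2 ^ 2 * (2 ^ (2 * k + 4)) ^ 2 := by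
          have := Nat.pow_le_pow_left (h1.trans h5) 2
          omega
      _ = 2 ^ (2 + (2 * k + 4) * 2) := by rw [← pow_mul, ← pow_add]
      _ ≤ 2 ^ (8 * k) := Nat.pow_le_pow_right two_pos (by omega)
  have hcb : classBound ((30 * D) ^ 4) r ≤ 2365444 * k ^ 4 := by
    unfold classBound
    have h1 : 96 * r * Nat.clog 2 (4 * (96 * r * Nat.clog 2 ((30 * D) ^ 4) + 1) ^ 2) + 1
        ≤ 769 * k ^ 2 := by
      have h2 := Nat.mul_le_mul hrk hinner
      have h3 : k * (8 * k) = 8 * k ^ 2 := by ring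
      have h4 : 0 < k ^ 2 := by positivity
      rw [mul_assoc]
      omega
    calc _ ≤ 4 * (769 * k ^ 2) ^ 2 := Nat.mul_le_mul_left _ (Nat.pow_le_pow_left h1 2)
      _ = _ := by ring
  have hk5 : k ^ 5 ≤ 3840 * (512 * l) := by
    have := pow_le_mul_two_pow 5 k
    simp only [Nat.factorial] at this
    omega
  have hkk5 : k ≤ k ^ 5 := Nat.le_self_pow (by norm_num) k
  have hbody : r * (3 + classBound ((30 * D) ^ 4) r) + 2 + 2 ^ r ≤ 10 ^ 13 * l := by
    have h1 : r * (3 + classBound ((30 * D) ^ 4) r) ≤ k * (3 + 2365444 * k ^ 4) :=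
      Nat.mul_le_mul hrk (by omega)
    have h2 : k * (3 + 2365444 * k ^ 4) = 3 * k + 2365444 * k ^ 5 := by ring
    omega
  unfold iterLength
  simp only [← hl, ← hr]
  have h1 : (l + 2) * (r * (3 + classBound ((30 * D) ^ 4) r) + 2 + 2 ^ r)
      ≤ (3 * l) * (10 ^ 13 * l) := Nat.mul_le_mul (by omega) hbody
  have h2 : (3 * l) * (10 ^ 13 * l) = 3 * 10 ^ 13 * l ^ 2 := by ring
  have h3 : 0 < l ^ 2 := by positivity
  omega

theorem totalLength_le {D : ℕ} (hD : 1 < D) (m : ℕ) :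
    totalLength D m ≤ 10 ^ 16 * Nat.clog 2 D ^ 2 * (m + 1) := by
  have h1 := Nat.mul_le_mul_left (11 * m + 1) (iterLength_le hD)
  have hl1 : 0 < Nat.clog 2 D := Nat.clog_pos one_lt_two hD
  have h2 : 0 < Nat.clog 2 D ^ 2 := by positivity
  have h3 : m + 1 ≤ Nat.clog 2 D ^ 2 * (m + 1) := Nat.le_mul_of_pos_left _ h2
  have h4 : (11 * m + 1) * (10 ^ 14 * Nat.clog 2 D ^ 2)
      ≤ 11 * 10 ^ 14 * (Nat.clog 2 D ^ 2 * (m + 1)) := by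
    have : 11 * 10 ^ 14 * (Nat.clog 2 D ^ 2 * (m + 1))
      = (11 * (m + 1)) * (10 ^ 14 * Nat.clog 2 D ^ 2) := by ring
    rw [this]
    exact Nat.mul_le_mul_right _ (by omega)
  unfold totalLength
  rw [mul_assoc]
  omega

theorem clog_le_logb (n : ℕ) (hn : 1 ≤ n) : (Nat.clog 2 n : ℝ) ≤ Real.logb 2 n + 1 := by
  rw [← Real.natCeil_logb_natCast 2 n, Nat.cast_ofNat]
  exact (Nat.ceil_lt_add_one (Real.logb_nonneg one_lt_two (by exact_mod_cast hn))).le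

/-- Number of bits of the edge identifiers. -/
def identBits (c n : ℕ) : ℕ := Nat.clog 2 n * (2 * c)

theorem pow_le_two_pow_identBits (c n : ℕ) : (n ^ c) ^ 2 ≤ 2 ^ identBits c n := by
  rw [identBits, pow_mul, ← pow_mul, mul_comm c 2]
  exact Nat.pow_le_pow_left (Nat.le_pow_clog one_lt_two _) _

end ListRounding

/-! ### The edge colouring algorithm. -/

open ListRounding in
/-- `(2 + ε)Δ`-edge colouring in the deterministic `LOCAL` model; `n ^ c` bounds the identifiers,
logarithms are to base two. -/
theorem corollary2 (c : ℕ) :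
    ∃ C : ℝ, 0 < C ∧ ∃ A : LocalAlgorithm,
      ∀ (V : Type) [Fintype V] (G : SimpleGraph V) [DecidableRel G.Adj]
        (ident : V → ℕ) (port : LocalAlgorithm.PortNumbering G) (ε : ℝ),
        Function.Injective ident →
        (∀ v, ident v < Fintype.card V ^ c) →
        2 ≤ G.maxDegree →
        1 / Real.logb 2 G.maxDegree < ε →
        A.ComputesEdgeColoring ident port ε ⌊(2 + ε) * (G.maxDegree : ℝ)⌋₊ ∧
        (A.rounds (Fintype.card V) G.maxDegree ε : ℝ) ≤
          C * ((Real.logb 2 G.maxDegree) ^ 2 * max 1 ε⁻¹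
            * max 1 (Real.logb 2 (Real.logb 2 G.maxDegree))
            * (max 1 (Real.logb 2 (Real.logb 2 (Real.logb 2 G.maxDegree)))) ^ (1.71 : ℝ)
            * Real.logb 2 (Fintype.card V)) := by
  classical
  have hprog : ∀ n Δ : ℕ, ∃ P : List (Step VertexState), 2 ≤ Δ →
      P.length ≤ totalLength (2 * Δ) (identBits c n) ∧
      ∀ (V : Type) [Fintype V] (H : SimpleGraph V) (x : V → VertexState),
        (∀ v, (H.nbr v).card < 2 * Δ) → (∀ v, (x v).cls < 2 ^ identBits c n) →
        (fun v => (x v).cls).Injective → (∀ v, (x v).color = none) →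
        ∀ v, ∃ a < 2 * Δ, (run H P x v).color = some a ∧
          ∀ u, H.Adj v u → (run H P x u).color ≠ some a := by
    intro n Δ
    by_cases h : 2 ≤ Δ
    · obtain ⟨P, hP⟩ := exists_coloring (D := 2 * Δ) (by omega) (identBits c n)
      exact ⟨P, fun _ => hP⟩
    · exact ⟨[], fun h' => absurd h' h⟩
  choose prog hprog using hprog
  let start : ℕ → VertexState := fun a => ⟨0, none, ∅, ∅, a⟩
  -- `10 ^ 16` is from `totalLength_le`, 9 from (3 log Δ)², and `(2 * c + 1) * 2` from the length of
  -- edge identifiers; the last 2 absorbs the extra first round.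
  refine ⟨10 ^ 16 * 9 * (2 * c + 1) * 2 * 2, by positivity,
    simulation prog start fun s => s.color.getD 0, ?_⟩
  intro V _ G _ ident port ε hinj hlt hΔ hε
  obtain ⟨hlen, hcol⟩ := hprog (Fintype.card V) G.maxDegree hΔ
  have hlogΔ : 1 ≤ Real.logb 2 G.maxDegree := by
    rw [Real.le_logb_iff_rpow_le one_lt_two (by positivity), Real.rpow_one]
    exact_mod_cast hΔ
  have hε0 : 0 < ε := lt_trans (by positivity) hε
  constructor
  · have hk : 2 * G.maxDegree ≤ ⌊(2 + ε) * (G.maxDegree : ℝ)⌋₊ := by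
      apply Nat.le_floor
      push_cast
      nlinarith [(Nat.cast_nonneg G.maxDegree : (0 : ℝ) ≤ G.maxDegree)]
    have hspec := hcol G.edgeSet G.lineGraph (startConfig start ident)
      (card_nbr_lineGraph_lt (by omega))
      (fun e => (startConfig_ident_lt hlt e).trans_le (pow_le_two_pow_identBits c _))
      (startConfig_ident_injective hinj) (fun _ => rfl)
    choose κ hκ hκ1 hκ2 using hspec
    refine ⟨SimpleGraph.Coloring.mk (fun e => ⟨κ e, (hκ e).trans_le hk⟩) ?_, fun v i => ?_⟩
    · intro e e' hee h
      have h1 : κ e = κ e' := by simpa using h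
      exact hκ2 e e' hee (by rw [hκ1, h1])
    · rw [finalOutput_simulation]
      change Option.getD (VertexState.color _) 0 = κ (edgeAt port v i)
      rw [hκ1]; rfl
  · obtain ⟨v, hv⟩ : ∃ v, G.degree v = G.maxDegree := by
      have : Nonempty V := by
        by_contra hne
        rw [not_nonempty_iff] at hne
        have : G.maxDegree = 0 := by simp
        omega
      obtain ⟨v, hv⟩ := G.exists_maximal_degree_vertex
      exact ⟨v, hv.symm⟩
    have hn : 2 ≤ Fintype.card V := by
      have := G.degree_lt_card_verts v
      omega
    have hlogn : 1 ≤ Real.logb 2 (Fintype.card V) := by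
      rw [Real.le_logb_iff_rpow_le one_lt_two (by positivity), Real.rpow_one]
      exact_mod_cast hn
    have hclogD : (Nat.clog 2 (2 * G.maxDegree) : ℝ) ≤ 3 * Real.logb 2 G.maxDegree := by
      have h1 := clog_le_logb (2 * G.maxDegree) (by omega)
      have h2 : Real.logb 2 ((2 * G.maxDegree : ℕ) : ℝ) = 1 + Real.logb 2 G.maxDegree := by
        push_cast
        rw [Real.logb_mul two_ne_zero (by positivity), Real.logb_self_eq_one one_lt_two]
      linarith
    have hclogn := clog_le_logb (Fintype.card V) (by omega)
    have hrounds : ((prog (Fintype.card V) G.maxDegree).length + 1 : ℝ)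
        ≤ 10 ^ 16 * 9 * (2 * c + 1) * 2 * 2 *
          (Real.logb 2 G.maxDegree ^ 2 * Real.logb 2 (Fintype.card V)) := by
      have h1 : ((prog (Fintype.card V) G.maxDegree).length : ℝ)
          ≤ 10 ^ 16 * (Nat.clog 2 (2 * G.maxDegree) : ℝ) ^ 2 *
            (Nat.clog 2 (Fintype.card V) * (2 * c) + 1) := by
        have := hlen.trans (totalLength_le (by omega) (identBits c (Fintype.card V)))
        rw [identBits] at this
        exact_mod_cast this
      have h2 : (Nat.clog 2 (Fintype.card V) * (2 * c) + 1 : ℝ)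
          ≤ (2 * c + 1) * (2 * Real.logb 2 (Fintype.card V)) := by
        have : (0 : ℝ) ≤ c := Nat.cast_nonneg c
        nlinarith
      have h3 : (Nat.clog 2 (2 * G.maxDegree) : ℝ) ^ 2 ≤ (3 * Real.logb 2 G.maxDegree) ^ 2 := by
        gcongr
      have h4 : 10 ^ 16 * (Nat.clog 2 (2 * G.maxDegree) : ℝ) ^ 2 *
            (Nat.clog 2 (Fintype.card V) * (2 * c) + 1)
          ≤ 10 ^ 16 * (3 * Real.logb 2 G.maxDegree) ^ 2 *
            ((2 * c + 1) * (2 * Real.logb 2 (Fintype.card V))) := by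
        gcongr
      have h5 : 1 ≤ Real.logb 2 G.maxDegree ^ 2 * Real.logb 2 (Fintype.card V) :=
        one_le_mul_of_one_le_of_one_le (one_le_pow₀ hlogΔ) hlogn
      have h6 : (1 : ℝ) ≤ 10 ^ 16 * 9 * (2 * c + 1) * 2 := by
        have : (0 : ℝ) ≤ c := Nat.cast_nonneg c
        linarith
      have h7 := one_le_mul_of_one_le_of_one_le h6 h5
      linarith
    have hfac : Real.logb 2 G.maxDegree ^ 2 * Real.logb 2 (Fintype.card V)
        ≤ (Real.logb 2 G.maxDegree) ^ 2 * max 1 ε⁻¹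
            * max 1 (Real.logb 2 (Real.logb 2 G.maxDegree))
            * (max 1 (Real.logb 2 (Real.logb 2 (Real.logb 2 G.maxDegree)))) ^ (1.71 : ℝ)
            * Real.logb 2 (Fintype.card V) := by
      have e1 : (1 : ℝ) ≤ max 1 ε⁻¹ := le_max_left _ _
      have e2 : (1 : ℝ) ≤ max 1 (Real.logb 2 (Real.logb 2 G.maxDegree)) := le_max_left _ _
      have e3 : (1 : ℝ) ≤
          (max 1 (Real.logb 2 (Real.logb 2 (Real.logb 2 G.maxDegree)))) ^ (1.71 : ℝ) :=
        Real.one_le_rpow (le_max_left _ _) (by norm_num)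
      rw [mul_assoc (Real.logb 2 G.maxDegree ^ 2), mul_assoc (Real.logb 2 G.maxDegree ^ 2)]
      refine mul_le_mul_of_nonneg_right (le_mul_of_one_le_right (by positivity) ?_) (by linarith)
      exact one_le_mul_of_one_le_of_one_le (one_le_mul_of_one_le_of_one_le e1 e2) e3
    calc (((simulation prog start fun s => s.color.getD 0).rounds
          (Fintype.card V) G.maxDegree ε : ℕ) : ℝ)
        = (prog (Fintype.card V) G.maxDegree).length + 1 := by simp [simulation]
      _ ≤ _ := hrounds
      _ ≤ _ := mul_le_mul_of_nonneg_left hfac (by positivity)
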